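/- Let $\mathbb F$ be $\mathbb R$ or $\mathbb C$, let $H,K$ be nonzero Hilbert spaces over $\mathbb F$, and let $V\subseteq B(K,H)$ be an operator space (a linear subspace). Let $$\mathcal S_V=\left\{\begin{bmatrix}\lambda I_H & x\\ y^* & \mu I_K\end{bmatrix}: x,y\in V,\ \lambda,\mu\in\mathbb F\right\}\subseteq B(H\oplus K)$$ be its Paulsen system, with the matrix cones $M_n(\mathcal S_V)_+$ and the matrix norms $\|\cdot\|_n$ inherited from $M_n(B(H\oplus K))=B((H\oplus K)^n)$. Let $\tau:\mathcal S_V\to\mathbb F$ be the normalized trace, $\tau\left(\begin{bmatrix}\lambda I & x\\ y^* & \mu I\end{bmatrix}\right)=\frac12(\lambda+\mu)$, let $\tau^{(n)}$ be its entrywise amplification, and put $K_n=\{u\in M_n(\mathcal S_V)_+:\tau^{(n)}(u)=I_n\}$. For $u=u^*\in M_n(\mathcal S_V)$ let $$\|u\|_{\tau,n}=\inf\{\|\tau^{(n)}(y+z)\|: u=y-z,\ y,z\in M_n(\mathcal S_V)_+\},$$ and for general $u\in M_n(\mathcal S_V)$ let $\|u\|_{\tau,n}=\left\|\begin{bmatrix}0&u\\u^*&0\end{bmatrix}\right\|_{\tau,2n}$.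 Then the following hold. 1. $\mathcal S_V$ is a matrix base ordered space with base $(K_n)$ and base function $\tau$. That is, it is a matrix ordered $*$-vector space; $(K_n)$ is matrix convex; $\tau$ is selfadjoint, positive and faithful on $(\mathcal S_V)_+$; for every $n$ and every $x=x^*\in M_n(\mathcal S_V)$ there are $t>0$ and $k\in K_n$ with $x\le tk$; and if $x=x^*\in M_n(\mathcal S_V)$ can, for every $\epsilon>0$, be written as $x=y-z$ with $y,z\in M_n(\mathcal S_V)_+$ and $\|\tau^{(n)}(y)\|,\|\tau^{(n)}(z)\|<\epsilon$, then $x=0$. Moreover $\mathcal S_V$ is based on $(K_n)$: every $u\in M_n(\mathcal S_V)_+$ is $\alpha^*k\alpha$ with $k\in K_n$ and $\alpha\in M_n$ positive. 2. The two formulas for $\|u\|_{\tau,n}$ agree if $u=u^*$, and with the matrix norms $\|\cdot\|_{\tau,n}$ the space $\mathcal S_V$ is a nc base norm space with nc base $(K_n)$ and base function $\tau$. That is, these norms satisfy Ruan's axioms of an operator space; $\|u^*\|_{\tau,n}=\|u\|_{\tau,n}$; the cones $M_n(\mathcal S_V)_+$, the sets $K_n$ and the hyperplanes $\{u:\tau^{(n)}(u)=I_n\}$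 are closed for these norms; $\|k\|_{\tau,n}\le1$ for $k\in K_n$; and for every $t>1$ each $u=u^*\in M_n(\mathcal S_V)$ with $\|u\|_{\tau,n}\le1$ is of the form $c_1x_1c_1-c_2x_2c_2$ with $x_i\in K_n$ and positive scalar matrices $c_i$ such that $\|c_1^2+c_2^2\|\le t$. 3. For all $n$ and all $u\in M_n(\mathcal S_V)$, $\ \tfrac12\|u\|_{\tau,n}\le\|u\|_n\le4\|u\|_{\tau,n}$. 4. Let $(\mathcal S_V)^d$ be the matrix ordered dual of $\mathcal S_V$: the space of functionals on $\mathcal S_V$ bounded for the original norm, with the involution $\varphi^*(u)=\overline{\varphi(u^*)}$, where $M_n((\mathcal S_V)^d)_+$ consists of the matrices $[\varphi_{ij}]$ for which $u\mapsto[\varphi_{ij}(u)]$ is a completely positive map $\mathcal S_V\to M_n$. Then $\tau$ is an archimedean matrix order unit of $(\mathcal S_V)^d$, so that this is an (abstract) operator system. With its matrix order unit norms $\inf\left\{t>0:\begin{bmatrix}t\,\tau\otimes I_n&\psi\\\psi^*&t\,\tau\otimes I_n\end{bmatrix}\ge0\right\}$, $\psi\in M_n((\mathcal S_V)^d)$,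 it is the operator space dual of $(\mathcal S_V,\{\|\cdot\|_{\tau,n}\})$: a functional is bounded for $\|\cdot\|_{\tau,1}$ if and only if it belongs to $(\mathcal S_V)^d$, and the matrix order unit norm of $\psi=[\psi_{ij}]$ equals the completely bounded norm of $u\mapsto[\psi_{ij}(u)]$ as a map into $M_n$ with respect to the norms $\|\cdot\|_{\tau,m}$. -/

import Mathlib

open scoped Matrix Matrix.Norms.L2Operator ComplexOrder InnerProductSpace

noncomputable section

namespace NcBase

/-! ### Matrices over a `*`-vector space

`M_n(E)` is `Matrix (Fin n) (Fin n) E`; scalar matrices carry the operator norm. -/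

section MatrixSpaces

variable {𝕜 : Type*} [RCLike 𝕜] {E : Type*} [AddCommGroup E] [Module 𝕜 E]

/-- The product `a x b` of a matrix `x` over `E` with rectangular scalar matrices. -/
def sandwich {m n : ℕ} (a : Matrix (Fin m) (Fin n) 𝕜) (x : Matrix (Fin n) (Fin n) E)
    (b : Matrix (Fin n) (Fin m) 𝕜) : Matrix (Fin m) (Fin m) E :=
  Matrix.of fun i j => ∑ k, ∑ l, (a i k * b l j) • x k l

/-- The `2 × 2` block matrix, read as an element of `M_{m+n}(E)`. -/
def blocks {m n : ℕ} (a : Matrix (Fin m) (Fin m) E) (b : Matrix (Fin m) (Fin n) E)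
    (c : Matrix (Fin n) (Fin m) E) (d : Matrix (Fin n) (Fin n) E) :
    Matrix (Fin (m + n)) (Fin (m + n)) E :=
  Matrix.reindex finSumFinEquiv finSumFinEquiv (Matrix.fromBlocks a b c d)

/-- The selfadjoint matrix with `x` in the `1`-`2` block and `x^*` in the `2`-`1` block. -/
def tilde [Star E] {n : ℕ} (x : Matrix (Fin n) (Fin n) E) :
    Matrix (Fin (n + n)) (Fin (n + n)) E :=
  blocks 0 x xᴴ 0

/-- An element of `E` as a `1 × 1` matrix. -/
def single (x : E) : Matrix (Fin 1) (Fin 1) E := Matrix.of fun _ _ => x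

/-- The entrywise amplification `f^{(n)} : M_n(E) → M_n` of a scalar functional. -/
def ampl (f : E →ₗ[𝕜] 𝕜) {n : ℕ} (x : Matrix (Fin n) (Fin n) E) : Matrix (Fin n) (Fin n) 𝕜 :=
  x.map f

/-- The nc hyperplane `H_n = {x ∈ M_n(E) : f^{(n)}(x) = I_n}`. -/
def ncHyperplane (f : E →ₗ[𝕜] 𝕜) (n : ℕ) : Set (Matrix (Fin n) (Fin n) E) :=
  {x | ampl f x = 1}

/-- The sets `K_n = M_n(E)_+ ∩ H_n` cut out of the cones `C n = M_n(E)_+` by `f`. -/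
def baseOf (C : ∀ n : ℕ, Set (Matrix (Fin n) (Fin n) E)) (f : E →ₗ[𝕜] 𝕜) (n : ℕ) :
    Set (Matrix (Fin n) (Fin n) E) :=
  C n ∩ ncHyperplane f n

/-- A set is closed for the topology given by the norm `N`. -/
def NormClosed {X : Type*} [AddCommGroup X] (N : X → ℝ) (S : Set X) : Prop :=
  ∀ x, (∀ ε > 0, ∃ y ∈ S, N (x - y) < ε) → x ∈ S

/-- The functional is selfadjoint: `f(x^*)` is the conjugate of `f(x)`. -/
def IsSelfadjointFunctional [Star E] (f : E →ₗ[𝕜] 𝕜) : Prop :=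
  ∀ x, f (star x) = star (f x)

variable (𝕜) in
/-- `E` with the sets `C n = M_n(E)_+` is a matrix ordered space: proper cones of selfadjoint
elements with `α^* M_n(E)_+ α ⊆ M_m(E)_+`. -/
structure IsMatrixOrdered [StarAddMonoid E] [StarModule 𝕜 E]
    (C : ∀ n : ℕ, Set (Matrix (Fin n) (Fin n) E)) : Prop where
  selfadjoint : ∀ n, ∀ x ∈ C n, xᴴ = x
  zero_mem : ∀ n, 0 ∈ C n
  add_mem : ∀ n, ∀ x ∈ C n, ∀ y ∈ C n, x + y ∈ C n
  smul_mem : ∀ n, ∀ t : ℝ, 0 ≤ t → ∀ x ∈ C n, (t : 𝕜) • x ∈ C n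
  proper : ∀ n, ∀ x ∈ C n, -x ∈ C n → x = 0
  compress : ∀ (n m : ℕ) (a : Matrix (Fin n) (Fin m) 𝕜), ∀ x ∈ C n, sandwich aᴴ x a ∈ C m

variable (𝕜) in
/-- `K` is a matrix convex set. -/
structure IsMatrixConvex (K : ∀ n : ℕ, Set (Matrix (Fin n) (Fin n) E)) : Prop where
  dsum : ∀ (m n : ℕ), ∀ x ∈ K m, ∀ y ∈ K n, blocks x 0 0 y ∈ K (m + n)
  compress : ∀ (n m : ℕ) (a : Matrix (Fin n) (Fin m) 𝕜), aᴴ * a = 1 →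
    ∀ x ∈ K n, sandwich aᴴ x a ∈ K m

variable (𝕜) in
/-- The functions `N n` on `M_n(E)` are norms satisfying Ruan's axioms. -/
structure IsOperatorSpace (N : ∀ n : ℕ, Matrix (Fin n) (Fin n) E → ℝ) : Prop where
  nonneg : ∀ n x, 0 ≤ N n x
  eq_zero : ∀ n x, N n x = 0 → x = 0
  smul : ∀ n (c : 𝕜) x, N n (c • x) = ‖c‖ * N n x
  triangle : ∀ n x y, N n (x + y) ≤ N n x + N n y
  dsum : ∀ (m n : ℕ) (x : Matrix (Fin m) (Fin m) E) (y : Matrix (Fin n) (Fin n) E),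
    N (m + n) (blocks x 0 0 y) = max (N m x) (N n y)
  bimodule : ∀ (m n : ℕ) (a : Matrix (Fin m) (Fin n) 𝕜) (x : Matrix (Fin n) (Fin n) E)
    (b : Matrix (Fin n) (Fin m) 𝕜), N m (sandwich a x b) ≤ ‖a‖ * N n x * ‖b‖

/-- `E` is based on `K`: every `u ∈ M_n(E)_+` is `α^* k α` with `k ∈ K_n` and `α` positive. -/
def IsBasedOn (𝕜 : Type*) [RCLike 𝕜] {E : Type*} [AddCommGroup E] [Module 𝕜 E]
    (C K : ∀ n : ℕ, Set (Matrix (Fin n) (Fin n) E)) : Prop :=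
  ∀ n, ∀ u ∈ C n, ∃ a : Matrix (Fin n) (Fin n) 𝕜, a.PosSemidef ∧ ∃ k ∈ K n, u = sandwich aᴴ k a

/-- A matrix base ordered space with base `K` and base function `f`. -/
structure IsMatrixBaseOrdered [StarAddMonoid E] [StarModule 𝕜 E]
    (C K : ∀ n : ℕ, Set (Matrix (Fin n) (Fin n) E)) (f : E →ₗ[𝕜] 𝕜) : Prop where
  matrixOrdered : IsMatrixOrdered 𝕜 C
  matrixConvex : IsMatrixConvex 𝕜 K
  selfadjoint : IsSelfadjointFunctional f
  positive : ∀ x, single x ∈ C 1 → 0 ≤ f x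
  faithful : ∀ x, single x ∈ C 1 → f x = 0 → x = 0
  base_eq : ∀ n, K n = C n ∩ ncHyperplane f n
  dominated : ∀ n, ∀ x : Matrix (Fin n) (Fin n) E, xᴴ = x →
    ∃ t : ℝ, 0 < t ∧ ∃ k ∈ K n, (t : 𝕜) • k - x ∈ C n
  separated : ∀ n, ∀ x : Matrix (Fin n) (Fin n) E, xᴴ = x →
    (∀ ε : ℝ, 0 < ε → ∃ y ∈ C n, ∃ z ∈ C n, x = y - z ∧ ‖ampl f y‖ < ε ∧ ‖ampl f z‖ < ε) → x = 0

/-- The base norm of a selfadjoint `x ∈ M_n(E)`: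
`inf {‖f^{(n)}(y + z)‖ : x = y - z, y, z ∈ M_n(E)_+}`. -/
def baseNormSa (C : ∀ n : ℕ, Set (Matrix (Fin n) (Fin n) E)) (f : E →ₗ[𝕜] 𝕜)
    (n : ℕ) (x : Matrix (Fin n) (Fin n) E) : ℝ :=
  sInf {r | ∃ y ∈ C n, ∃ z ∈ C n, x = y - z ∧ r = ‖ampl f (y + z)‖}

/-- The nc base norm of a general `x ∈ M_n(E)`: the base norm of the selfadjoint matrix
`[0, x; x^*, 0]` in `M_{2n}(E)`. -/
def baseNorm [Star E] (C : ∀ n : ℕ, Set (Matrix (Fin n) (Fin n) E)) (f : E →ₗ[𝕜] 𝕜)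
    (n : ℕ) (x : Matrix (Fin n) (Fin n) E) : ℝ :=
  baseNormSa C f (n + n) (tilde x)

/-- A nc base norm space with cones `C`, matrix norms `N`, nc base `K` and base function `f`. -/
structure IsNcBaseNormSpace [StarAddMonoid E] [StarModule 𝕜 E]
    (C : ∀ n : ℕ, Set (Matrix (Fin n) (Fin n) E)) (N : ∀ n : ℕ, Matrix (Fin n) (Fin n) E → ℝ)
    (K : ∀ n : ℕ, Set (Matrix (Fin n) (Fin n) E)) (f : E →ₗ[𝕜] 𝕜) : Prop where
  matrixOrdered : IsMatrixOrdered 𝕜 C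
  operatorSpace : IsOperatorSpace 𝕜 N
  cone_closed : ∀ n, NormClosed (N n) (C n)
  star_isometric : ∀ n x, N n xᴴ = N n x
  matrixConvex : IsMatrixConvex 𝕜 K
  base_subset : ∀ n, ∀ x ∈ K n, x ∈ C n ∧ N n x ≤ 1
  base_closed : ∀ n, NormClosed (N n) (K n)
  ball_subset : ∀ t : ℝ, 1 < t → ∀ n, ∀ x : Matrix (Fin n) (Fin n) E, xᴴ = x → N n x ≤ 1 →
    ∃ c₁ c₂ : Matrix (Fin n) (Fin n) 𝕜, c₁.PosSemidef ∧ c₂.PosSemidef ∧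
      ‖c₁ ^ 2 + c₂ ^ 2‖ ≤ t ∧
      ∃ x₁ ∈ K n, ∃ x₂ ∈ K n, x = sandwich c₁ x₁ c₁ - sandwich c₂ x₂ c₂
  hyperplane_closed : ∀ n, NormClosed (N n) (ncHyperplane f n)
  selfadjoint : IsSelfadjointFunctional f
  positive : ∀ x, single x ∈ C 1 → 0 ≤ f x
  base_eq : ∀ n, K n = C n ∩ ncHyperplane f n

/-! ### Archimedean matrix order units -/

/-- `e ⊗ I_n` with the real coefficient `t`. -/
def unitDiag (𝕜 : Type*) [RCLike 𝕜] {E : Type*} [AddCommGroup E] [Module 𝕜 E]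
    (e : E) (t : ℝ) (n : ℕ) : Matrix (Fin n) (Fin n) E :=
  Matrix.diagonal fun _ => (t : 𝕜) • e

variable (𝕜) in
/-- An abstract operator system: a matrix ordered space such that `e ⊗ I_n` is an archimedean
order unit of `M_n(E)` for every `n`. -/
structure IsOperatorSystem [StarAddMonoid E] [StarModule 𝕜 E]
    (C : ∀ n : ℕ, Set (Matrix (Fin n) (Fin n) E)) (e : E) : Prop where
  matrixOrdered : IsMatrixOrdered 𝕜 C
  selfadjoint : star e = e
  orderUnit : ∀ n, ∀ x : Matrix (Fin n) (Fin n) E, xᴴ = x →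
    ∃ t : ℝ, 0 < t ∧ unitDiag 𝕜 e t n - x ∈ C n
  archimedean : ∀ n, ∀ x : Matrix (Fin n) (Fin n) E,
    (∀ t : ℝ, 0 < t → unitDiag 𝕜 e t n + x ∈ C n) → x ∈ C n

/-- The matrix order unit norms:
the infimum of the `t > 0` with `[t e, x; x^*, t e] ≥ 0` in `M_{2n}(E)`. -/
def orderUnitNorm (𝕜 : Type*) [RCLike 𝕜] {E : Type*} [AddCommGroup E] [Module 𝕜 E] [Star E]
    (C : ∀ n : ℕ, Set (Matrix (Fin n) (Fin n) E)) (e : E)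
    (n : ℕ) (x : Matrix (Fin n) (Fin n) E) : ℝ :=
  sInf {t | 0 < t ∧ blocks (unitDiag 𝕜 e t n) x xᴴ (unitDiag 𝕜 e t n) ∈ C (n + n)}

/-! ### Matricial duality -/

/-- For a matrix `ψ` of functionals, seen as the map `E → M_n`, `x ↦ [ψ_ij(x)]`, the value
at `x ∈ M_m(E)` of its amplification `M_m(E) → M_m(M_n)`. -/
def pairing {m n : ℕ} (ψ : Matrix (Fin n) (Fin n) (E →ₗ[𝕜] 𝕜)) (x : Matrix (Fin m) (Fin m) E) :
    Matrix (Fin m × Fin n) (Fin m × Fin n) 𝕜 :=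
  Matrix.of fun p q => ψ p.2 q.2 (x p.1 q.1)

/-- The canonical dual cones on a space `F` of functionals on `E`: the matrices over `F` that
are completely positive as maps `E → M_n`. -/
def dualCone (C : ∀ n : ℕ, Set (Matrix (Fin n) (Fin n) E)) {F : Type*} [AddCommGroup F]
    [Module 𝕜 F] (ι : F →ₗ[𝕜] (E →ₗ[𝕜] 𝕜)) (n : ℕ) : Set (Matrix (Fin n) (Fin n) F) :=
  {ψ | ∀ m, ∀ x ∈ C m, (pairing (ψ.map ι) x).PosSemidef}

/-- `F`, with matrix norms `N'`, is the operator space dual of `E` with matrix norms `N`: via `ι`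
it is the space of all bounded functionals, and the norm on `M_n(F)` is the completely
bounded norm of maps `E → M_n`. -/
structure IsOperatorSpaceDual (N : ∀ n : ℕ, Matrix (Fin n) (Fin n) E → ℝ) {F : Type*}
    [AddCommGroup F] [Module 𝕜 F] (N' : ∀ n : ℕ, Matrix (Fin n) (Fin n) F → ℝ)
    (ι : F →ₗ[𝕜] (E →ₗ[𝕜] 𝕜)) : Prop where
  injective : Function.Injective ι
  range_eq : ∀ f : E →ₗ[𝕜] 𝕜,
    (∃ φ, ι φ = f) ↔ ∃ c : ℝ, ∀ x, ‖f x‖ ≤ c * N 1 (single x)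
  norm_eq : ∀ n (ψ : Matrix (Fin n) (Fin n) F),
    IsLUB {r | ∃ (m : ℕ) (x : Matrix (Fin m) (Fin m) E), N m x ≤ 1 ∧
      r = ‖pairing (ψ.map ι) x‖} (N' n ψ)

end MatrixSpaces

/-! ### Concrete operator matrices -/

section Concrete

variable {𝕜 : Type*} [RCLike 𝕜] {L : Type*} [NormedAddCommGroup L] [InnerProductSpace 𝕜 L]

/-- A matrix of operators on `L`, acting on the `n`-fold Hilbert space direct sum of `L`. -/
def matOp {n : ℕ} (T : Matrix (Fin n) (Fin n) (L →L[𝕜] L)) :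
    PiLp 2 (fun _ : Fin n => L) →L[𝕜] PiLp 2 (fun _ : Fin n => L) :=
  ((PiLp.continuousLinearEquiv 2 𝕜 (fun _ : Fin n => L)).symm :
      (Fin n → L) →L[𝕜] PiLp 2 (fun _ : Fin n => L)) ∘L
    (ContinuousLinearMap.pi fun i => ∑ j, T i j ∘L PiLp.proj 2 (fun _ : Fin n => L) j)

theorem matOp_apply {n : ℕ} (T : Matrix (Fin n) (Fin n) (L →L[𝕜] L))
    (v : PiLp 2 (fun _ : Fin n => L)) (i : Fin n) : matOp T v i = ∑ j, T i j (v j) := by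
  simp [matOp]

/-- The positive cone of `M_n(S)` for a subspace `S` of `B(L)`. -/
def opCone (S : Submodule 𝕜 (L →L[𝕜] L)) (n : ℕ) : Set (Matrix (Fin n) (Fin n) S) :=
  {x | (matOp (x.map fun T => (T : L →L[𝕜] L))).IsPositive}

/-- The operator norm on `M_n(S)` for a subspace `S` of `B(L)`. -/
def opMatNorm (S : Submodule 𝕜 (L →L[𝕜] L)) (n : ℕ) (x : Matrix (Fin n) (Fin n) S) : ℝ :=
  ‖matOp (x.map fun T => (T : L →L[𝕜] L))‖

end Concrete

/-! ### The Paulsen system -/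

section Paulsen

variable {𝕜 : Type*} [RCLike 𝕜]
  {H : Type*} [NormedAddCommGroup H] [InnerProductSpace 𝕜 H] [CompleteSpace H]
  {K : Type*} [NormedAddCommGroup K] [InnerProductSpace 𝕜 K] [CompleteSpace K]

/-- The operator `[a I_H, x; y^*, b I_K]` on the Hilbert space sum `H ⊕ K`. -/
def blockOp (a : 𝕜) (x y : K →L[𝕜] H) (b : 𝕜) : WithLp 2 (H × K) →L[𝕜] WithLp 2 (H × K) :=
  ((WithLp.prodContinuousLinearEquiv 2 𝕜 H K).symm : (H × K) →L[𝕜] WithLp 2 (H × K)) ∘L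
    (((a • ContinuousLinearMap.fst 𝕜 H K + x ∘L ContinuousLinearMap.snd 𝕜 H K).prod
      (ContinuousLinearMap.adjoint y ∘L ContinuousLinearMap.fst 𝕜 H K
        + b • ContinuousLinearMap.snd 𝕜 H K)) ∘L
    (WithLp.prodContinuousLinearEquiv 2 𝕜 H K : WithLp 2 (H × K) →L[𝕜] (H × K)))

theorem blockOp_apply (a : 𝕜) (x y : K →L[𝕜] H) (b : 𝕜) (v : WithLp 2 (H × K)) :
    blockOp a x y b v = WithLp.toLp 2
      (a • v.fst + x v.snd, ContinuousLinearMap.adjoint y v.fst + b • v.snd) := by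
  simp [blockOp]

theorem star_blockOp (a : 𝕜) (x y : K →L[𝕜] H) (b : 𝕜) :
    star (blockOp a x y b) = blockOp (star a) y x (star b) := by
  symm
  rw [ContinuousLinearMap.star_eq_adjoint, ContinuousLinearMap.eq_adjoint_iff]
  intro v w
  have h1 : ∀ u : WithLp 2 (H × K), u.ofLp.1 = u.fst := fun _ => rfl
  have h2 : ∀ u : WithLp 2 (H × K), u.ofLp.2 = u.snd := fun _ => rfl
  simp only [blockOp_apply, WithLp.prod_inner_apply, inner_add_left, inner_add_right,
    inner_smul_left, inner_smul_right, ContinuousLinearMap.adjoint_inner_left,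
    ContinuousLinearMap.adjoint_inner_right, RCLike.star_def, RCLike.conj_conj, h1, h2]
  ring

/-- The Paulsen system of an operator space `V ⊆ B(K, H)`, as a subspace of `B(H ⊕ K)`. -/
def paulsen (V : Submodule 𝕜 (K →L[𝕜] H)) :
    Submodule 𝕜 (WithLp 2 (H × K) →L[𝕜] WithLp 2 (H × K)) where
  carrier := {T | ∃ a b : 𝕜, ∃ x ∈ V, ∃ y ∈ V, T = blockOp a x y b}
  zero_mem' := by
    refine ⟨0, 0, 0, V.zero_mem, 0, V.zero_mem, ?_⟩
    refine ContinuousLinearMap.ext fun v => ?_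
    rw [blockOp_apply]
    simp
    rfl
  add_mem' := by
    rintro _ _ ⟨a, b, x, hx, y, hy, rfl⟩ ⟨a', b', x', hx', y', hy', rfl⟩
    refine ⟨a + a', b + b', x + x', V.add_mem hx hx', y + y', V.add_mem hy hy', ?_⟩
    refine ContinuousLinearMap.ext fun v => ?_
    rw [add_apply, blockOp_apply, blockOp_apply, blockOp_apply,
      ← WithLp.toLp_add, Prod.mk_add_mk]
    simp only [add_smul, map_add, add_apply]
    congr 2 <;> abel
  smul_mem' := by
    rintro c _ ⟨a, b, x, hx, y, hy, rfl⟩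
    refine ⟨c * a, c * b, c • x, V.smul_mem c hx, star c • y, V.smul_mem _ hy, ?_⟩
    refine ContinuousLinearMap.ext fun v => ?_
    rw [smul_apply, blockOp_apply, blockOp_apply, ← WithLp.toLp_smul,
      Prod.smul_mk]
    simp [mul_smul, map_smulₛₗ]

theorem adjoint_mem_paulsen (V : Submodule 𝕜 (K →L[𝕜] H))
    {T : WithLp 2 (H × K) →L[𝕜] WithLp 2 (H × K)} (hT : T ∈ paulsen V) :
    ContinuousLinearMap.adjoint T ∈ paulsen V := by
  obtain ⟨a, b, x, hx, y, hy, rfl⟩ := hT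
  exact ⟨star a, star b, y, hy, x, hx, star_blockOp a x y b⟩

instance (V : Submodule 𝕜 (K →L[𝕜] H)) : AddCommGroup (paulsen V) :=
  Submodule.addCommGroup (paulsen V)

instance (V : Submodule 𝕜 (K →L[𝕜] H)) : AddMonoid (paulsen V) :=
  (Submodule.addCommGroup (paulsen V)).toAddMonoid

/-- The involution of the Paulsen system is the adjoint of operators. -/
instance (V : Submodule 𝕜 (K →L[𝕜] H)) : StarAddMonoid (paulsen V) where
  star T := ⟨ContinuousLinearMap.adjoint T.1, adjoint_mem_paulsen V T.2⟩
  star_involutive T := Subtype.ext (ContinuousLinearMap.adjoint_adjoint T.1)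
  star_add S T := Subtype.ext (map_add ContinuousLinearMap.adjoint S.1 T.1)

theorem coe_star_paulsen (V : Submodule 𝕜 (K →L[𝕜] H)) (T : paulsen V) :
    (star T).1 = ContinuousLinearMap.adjoint T.1 := rfl

instance (V : Submodule 𝕜 (K →L[𝕜] H)) : StarModule 𝕜 (paulsen V) where
  star_smul c T := Subtype.ext (map_smulₛₗ ContinuousLinearMap.adjoint c T.1)

/-- The element `[a I, x; y^*, b I]` of the Paulsen system. -/
def paulsenMk (V : Submodule 𝕜 (K →L[𝕜] H)) (a : 𝕜) (x y : V) (b : 𝕜) : paulsen V :=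
  ⟨blockOp a x y b, a, b, x, x.2, y, y.2, rfl⟩

theorem exists_unit_vector (𝕜 : Type*) [RCLike 𝕜] (X : Type*) [NormedAddCommGroup X]
    [InnerProductSpace 𝕜 X] [Nontrivial X] : ∃ v : X, ‖v‖ = 1 := by
  let : NormedSpace ℝ X := NormedSpace.restrictScalars ℝ 𝕜 X
  exact exists_norm_eq X zero_le_one

/-- The vector functional `T ↦ ⟨T v, v⟩` on a subspace of `B(L)`. -/
def vecFunctional {L : Type*} [NormedAddCommGroup L] [InnerProductSpace 𝕜 L]
    (S : Submodule 𝕜 (L →L[𝕜] L)) (v : L) : S →ₗ[𝕜] 𝕜 where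
  toFun T := ⟪v, (T : L →L[𝕜] L) v⟫_𝕜
  map_add' S T := by simp [inner_add_right]
  map_smul' c T := by simp [inner_smul_right]

/-- The normalized trace on the Paulsen system. It is written through unit vectors of `H` and
`K`, which makes it visibly linear and bounded; by `trLin_mk` it is the functional
`[a I, x; y^*, b I] ↦ (a + b) / 2`. -/
def trLin [Nontrivial H] [Nontrivial K] (V : Submodule 𝕜 (K →L[𝕜] H)) : paulsen V →ₗ[𝕜] 𝕜 :=
  (1 / 2 : 𝕜) •
    (vecFunctional (paulsen V) (WithLp.toLp 2 ((exists_unit_vector 𝕜 H).choose, (0 : K)))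
      + vecFunctional (paulsen V) (WithLp.toLp 2 ((0 : H), (exists_unit_vector 𝕜 K).choose)))

theorem trLin_mk [Nontrivial H] [Nontrivial K] (V : Submodule 𝕜 (K →L[𝕜] H))
    (a : 𝕜) (x y : V) (b : 𝕜) : trLin V (paulsenMk V a x y b) = (1 / 2) * (a + b) := by
  have h1 := (exists_unit_vector 𝕜 H).choose_spec
  have h2 := (exists_unit_vector 𝕜 K).choose_spec
  simp [trLin, vecFunctional, paulsenMk, blockOp_apply, WithLp.prod_inner_apply,
    inner_smul_right, h1, h2]
  ring

/-- The underlying space of the matrix ordered dual `(S_V)^d` of the Paulsen system: the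
functionals that are bounded for the original norm. -/
def paulsenDual (V : Submodule 𝕜 (K →L[𝕜] H)) : Submodule 𝕜 (paulsen V →ₗ[𝕜] 𝕜) where
  carrier := {f | ∃ c : ℝ, ∀ T : paulsen V,
    ‖f T‖ ≤ c * ‖(T : WithLp 2 (H × K) →L[𝕜] WithLp 2 (H × K))‖}
  zero_mem' := ⟨0, by simp⟩
  add_mem' := by
    rintro f g ⟨c, hc⟩ ⟨d, hd⟩
    exact ⟨c + d, fun T => (norm_add_le _ _).trans
      ((add_le_add (hc T) (hd T)).trans_eq (add_mul _ _ _).symm)⟩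
  smul_mem' := by
    rintro a f ⟨c, hc⟩
    refine ⟨‖a‖ * c, fun T => ?_⟩
    rw [LinearMap.smul_apply, norm_smul, mul_assoc]
    exact mul_le_mul_of_nonneg_left (hc T) (norm_nonneg a)

/-- The involution `f^*(T) = conj (f(T^*))` on functionals. -/
def adjFunctional (V : Submodule 𝕜 (K →L[𝕜] H)) (f : paulsen V →ₗ[𝕜] 𝕜) :
    paulsen V →ₗ[𝕜] 𝕜 where
  toFun T := star (f (star T))
  map_add' S T := by simp
  map_smul' c T := by simp [star_smul]

instance (V : Submodule 𝕜 (K →L[𝕜] H)) : AddCommGroup (paulsenDual V) :=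
  Submodule.addCommGroup (paulsenDual V)

instance (V : Submodule 𝕜 (K →L[𝕜] H)) : AddMonoid (paulsenDual V) :=
  (Submodule.addCommGroup (paulsenDual V)).toAddMonoid

instance (V : Submodule 𝕜 (K →L[𝕜] H)) : StarAddMonoid (paulsenDual V) where
  star f := ⟨adjFunctional V f, by
    obtain ⟨c, hc⟩ := f.2
    refine ⟨c, fun T => ?_⟩
    have h := hc (star T)
    rw [coe_star_paulsen, LinearIsometryEquiv.norm_map] at h
    exact (norm_star _).le.trans h⟩
  star_involutive f := Subtype.ext (LinearMap.ext fun T => by simp [adjFunctional])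
  star_add f g := Subtype.ext (LinearMap.ext fun T => by simp [adjFunctional])

theorem star_paulsenDual_apply (V : Submodule 𝕜 (K →L[𝕜] H)) (f : paulsenDual V)
    (T : paulsen V) : (star f : paulsenDual V).1 T = star (f.1 (star T)) := rfl

instance (V : Submodule 𝕜 (K →L[𝕜] H)) : StarModule 𝕜 (paulsenDual V) where
  star_smul c f := Subtype.ext (LinearMap.ext fun T => by simp [star_paulsenDual_apply])

theorem vecFunctional_bound {L : Type*} [NormedAddCommGroup L] [InnerProductSpace 𝕜 L]
    (S : Submodule 𝕜 (L →L[𝕜] L)) (v : L) (T : S) :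
    ‖vecFunctional S v T‖ ≤ ‖v‖ * ‖v‖ * ‖(T : L →L[𝕜] L)‖ := by
  have h1 : ‖vecFunctional S v T‖ ≤ ‖v‖ * ‖(T : L →L[𝕜] L) v‖ := norm_inner_le_norm _ _
  have h2 := mul_le_mul_of_nonneg_left ((T : L →L[𝕜] L).le_opNorm v) (norm_nonneg v)
  linarith

theorem trLin_mem [Nontrivial H] [Nontrivial K] (V : Submodule 𝕜 (K →L[𝕜] H)) :
    trLin V ∈ paulsenDual V :=
  (paulsenDual V).smul_mem _ ((paulsenDual V).add_mem
    ⟨_, vecFunctional_bound (paulsen V) _⟩ ⟨_, vecFunctional_bound (paulsen V) _⟩)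

section Trace

variable [Nontrivial H] [Nontrivial K] (V : Submodule 𝕜 (K →L[𝕜] H))

/-- The normalized trace as an element of the dual. -/
def trDual : paulsenDual V := ⟨trLin V, trLin_mem V⟩

/-- The sets `K_n` of the `u ∈ M_n(S_V)_+` with `τ^{(n)}(u) = I_n`. -/
def paulsenBase : ∀ n : ℕ, Set (Matrix (Fin n) (Fin n) (paulsen V)) :=
  baseOf (opCone (paulsen V)) (trLin V)

/-- The nc base matrix norms of the Paulsen system. -/
def tauNorm : ∀ n : ℕ, Matrix (Fin n) (Fin n) (paulsen V) → ℝ :=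
  baseNorm (opCone (paulsen V)) (trLin V)

/-- The matrix cones of `(S_V)^d`: matrices of functionals that are completely positive maps. -/
def dualPos : ∀ n : ℕ, Set (Matrix (Fin n) (Fin n) (paulsenDual V)) :=
  dualCone (opCone (paulsen V)) (paulsenDual V).subtype

/-- The matrix norms of `(S_V)^d`: the order unit norms of `τ`. -/
def dualNorm : ∀ n : ℕ, Matrix (Fin n) (Fin n) (paulsenDual V) → ℝ :=
  orderUnitNorm 𝕜 (dualPos V) (trDual V)

end Trace

end Paulsen

end NcBase

end

/-!
The argument rests on one description of the base norm. For a matrix base ordered space `E` with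
base function `f`, and for `u ∈ M_n(E)` and `r ≥ 0`, say that `BaseBound C f r u` holds if there
are `p, q` with `[p, u; u^*, q] ≥ 0` and `f(p) ≤ r`, `f(q) ≤ r`. If `tilde u = y - z` with positive
`y, z` and `f(y + z) ≤ r`, conjugating `z` with the diagonal matrix `1 ⊕ -1` and adding `y` gives
such a pair; conversely `[p, u; u^*, q]` and `[p, -u; -u^*, q]` have half-difference `tilde u`. So
the bounds `BaseBound` determine the base norm (`BaseBound.baseNorm_le`,
`baseBound_of_baseNorm_lt`), and Ruan's axioms, the invariance under the involution and the
agreement of the two formulas for selfadjoint `u` become manipulations of positive block matrices.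

A positive `u` with `f(u) = d` is `a k a` with `a` the square root of `d` and `k` in the base:
compress `u` with the inverse of `a` on the range of `d`, and complete by any element of the base on
the kernel (`isBasedOn_base`). There the corner of `u` is zero by the separation property, and then
so are the off-diagonal parts (`eq_zero_of_isPos_fromBlocks_zero`). Applied to the two summands of a
selfadjoint matrix this gives the decomposition of the unit ball.

For the Paulsen system the reflection `(h, k) ↦ (h, -k)` shows that a positive matrix is at most
twice its diagonal part, and the diagonal part is a pair of scalar matrices with sum `2 τ(p)`; hence
`p ≤ 4 r` whenever `p ≥ 0` and `τ(p) ≤ r` (`unitDiag_sub_mem_opCone_of_trace_le`). As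
`‖u‖ ≤ r` means `[r, u; u^*, r] ≥ 0`, this yields `‖u‖_τ ≤ ‖u‖ ≤ 4 ‖u‖_τ`, and with it faithfulness,
the separation property and the closedness of the cones.

Since every positive matrix comes from the base, a matrix `ψ` of functionals is completely positive
as soon as its pairings with base elements are positive (`mem_dualCone_of_base`); as base elements
have base norm at most one, a completely bounded selfadjoint `ψ` is dominated by a multiple of `τ`.
For general `ψ`, the matrix `[t τ, ψ; ψ^*, t τ]` is completely positive exactly if
`‖ψ(u)‖ ≤ t` for all `u` with `‖u‖_τ ≤ 1`. From left to right one pairs with a positive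
`[p, u; u^*, q]`; from right to left one again tests on the base. Finiteness of the completely
bounded norm holds because a bounded functional is completely bounded with the same constant
(`norm_map_le_of_bounded`).
-/

open scoped Matrix Matrix.Norms.L2Operator ComplexOrder InnerProductSpace

noncomputable section

namespace NcBase

/-! ### Scalar matrices: norm bounds as positivity -/

section ScalarMatrices

set_option linter.unusedSectionVars false

variable {𝕜 : Type*} [RCLike 𝕜] {ι κ : Type*} [Fintype ι] [Fintype κ]
  [DecidableEq ι] [DecidableEq κ]

/-- A positive semidefinite matrix `T` has a square root `a`, a generalised inverse `b` of the
square root and a kernel projection `e`. -/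
theorem exists_sqrt_inverse_kernel {T : Matrix ι ι 𝕜} (hT : T.PosSemidef) :
    ∃ a b e : Matrix ι ι 𝕜, a.PosSemidef ∧ bᴴ = b ∧ eᴴ = e ∧ a * b = 1 - e ∧ b * a = 1 - e ∧
      a * e = 0 ∧ e * T * e = 0 ∧ b * T * b + e * e = 1 ∧ a * a = T := by
  set U : Matrix ι ι 𝕜 := (hT.1.eigenvectorUnitary : Matrix ι ι 𝕜) with hU
  have hUU : Uᴴ * U = 1 := by
    have := Unitary.coe_star_mul_self hT.1.eigenvectorUnitary
    rwa [Matrix.star_eq_conjTranspose] at this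
  have hUU' : U * Uᴴ = 1 := mul_eq_one_comm.mp hUU
  set l : ι → ℝ := hT.1.eigenvalues with hl
  have hl0 : ∀ i, 0 ≤ l i := hT.eigenvalues_nonneg
  let D (g : ι → ℝ) : Matrix ι ι 𝕜 := U * Matrix.diagonal (fun i => (g i : 𝕜)) * Uᴴ
  have hTD : T = D l := by
    have := hT.1.spectral_theorem
    rw [Unitary.conjStarAlgAut_apply] at this
    exact this
  have hmul : ∀ g h, D g * D h = D fun i => g i * h i := by
    intro g h
    calc D g * D h = U * Matrix.diagonal (fun i => (g i : 𝕜)) * (Uᴴ * U)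
          * Matrix.diagonal (fun i => (h i : 𝕜)) * Uᴴ := by simp only [D, Matrix.mul_assoc]
      _ = _ := by
        rw [hUU, Matrix.mul_one, Matrix.mul_assoc U, Matrix.diagonal_mul_diagonal]
        simp [D]
  have hone : D (fun _ => 1) = 1 := by simp [D, hUU']
  have hzero : D (fun _ => 0) = 0 := by simp [D]
  have hsub : ∀ g h, D g - D h = D fun i => g i - h i := by
    intro g h
    simp only [D, RCLike.ofReal_sub, ← Matrix.diagonal_sub, Matrix.mul_sub, Matrix.sub_mul]
  have hadd : ∀ g h, D g + D h = D fun i => g i + h i := by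
    intro g h
    simp only [D, RCLike.ofReal_add, ← Matrix.diagonal_add, Matrix.mul_add, Matrix.add_mul]
  have hstar : ∀ g, (D g)ᴴ = D g := by
    intro g
    simp only [D, Matrix.conjTranspose_mul, Matrix.conjTranspose_conjTranspose,
      Matrix.diagonal_conjTranspose, Matrix.mul_assoc]
    congr 3
    ext i
    simp
  refine ⟨D fun i => √(l i), D fun i => (√(l i))⁻¹, D fun i => if l i = 0 then 1 else 0,
    ?_, hstar _, hstar _, ?_, ?_, ?_, ?_, ?_, ?_⟩
  · refine Matrix.PosSemidef.mul_mul_conjTranspose_same ?_ U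
    refine Matrix.PosSemidef.diagonal fun i => ?_
    exact RCLike.ofReal_nonneg.mpr (Real.sqrt_nonneg _)
  all_goals
    try rw [hTD]
    first | rw [← hone] | rw [← hzero] | skip
    simp only [hmul, hsub, hadd]
    congr 1
    ext i
    by_cases h : l i = 0
    · simp [h]
    · have : √(l i) ≠ 0 := (Real.sqrt_ne_zero (hl0 i)).mpr h
      have h2 := Real.mul_self_sqrt (hl0 i)
      first | (simp [h, h2]; done) | (field_simp; simp [h, pow_two, h2])

theorem star_dotProduct_mulVec_eq_inner (A : Matrix ι ι 𝕜) (v : ι → 𝕜) :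
    star v ⬝ᵥ (A *ᵥ v) = ⟪WithLp.toLp 2 v, WithLp.toLp 2 (A *ᵥ v)⟫_𝕜 := by
  rw [EuclideanSpace.inner_eq_star_dotProduct, dotProduct_comm]

theorem star_dotProduct_self_eq_norm_sq (v : ι → 𝕜) :
    star v ⬝ᵥ v = ((‖WithLp.toLp 2 v‖ ^ 2 : ℝ) : 𝕜) := by
  have h := inner_self_eq_norm_sq_to_K (𝕜 := 𝕜) (WithLp.toLp 2 v)
  rw [EuclideanSpace.inner_eq_star_dotProduct, dotProduct_comm] at h
  rw [h]
  push_cast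
  rfl

theorem posSemidef_smul_one_sub {A : Matrix ι ι 𝕜} (hA : A.IsHermitian) {r : ℝ}
    (h : ‖A‖ ≤ r) : ((r : 𝕜) • (1 : Matrix ι ι 𝕜) - A).PosSemidef := by
  have hH : ((r : 𝕜) • (1 : Matrix ι ι 𝕜) - A).IsHermitian := by
    unfold Matrix.IsHermitian
    rw [Matrix.conjTranspose_sub, Matrix.conjTranspose_smul, hA.eq]
    simp
  refine Matrix.PosSemidef.of_dotProduct_mulVec_nonneg hH fun v => ?_
  rw [RCLike.nonneg_iff]
  refine ⟨?_, hH.im_star_dotProduct_mulVec_self v⟩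
  rw [Matrix.sub_mulVec, Matrix.smul_mulVec, Matrix.one_mulVec, dotProduct_sub, dotProduct_smul,
    star_dotProduct_self_eq_norm_sq, star_dotProduct_mulVec_eq_inner, map_sub, smul_eq_mul,
    ← RCLike.ofReal_mul, RCLike.ofReal_re, sub_nonneg]
  have h1 := Matrix.l2_opNorm_mulVec A (WithLp.toLp 2 v)
  have h2 := re_inner_le_norm (𝕜 := 𝕜) (WithLp.toLp 2 v) (WithLp.toLp 2 (A *ᵥ v))
  have h3 := norm_nonneg (WithLp.toLp 2 v)
  refine h2.trans ?_
  calc ‖WithLp.toLp 2 v‖ * ‖WithLp.toLp 2 (A *ᵥ v)‖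
      ≤ ‖WithLp.toLp 2 v‖ * (r * ‖WithLp.toLp 2 v‖) := by
        gcongr
        exact h1.trans (by gcongr)
    _ = _ := by ring

theorem norm_le_of_posSemidef_sub_conjTranspose_mul_self {B : Matrix κ ι 𝕜} {r : ℝ} (hr : 0 ≤ r)
    (h : (((r ^ 2 : ℝ) : 𝕜) • (1 : Matrix ι ι 𝕜) - Bᴴ * B).PosSemidef) : ‖B‖ ≤ r := by
  rw [Matrix.l2_opNorm_def]
  refine ContinuousLinearMap.opNorm_le_bound _ hr fun v => ?_
  have h1 := (RCLike.nonneg_iff.mp (h.dotProduct_mulVec_nonneg v.ofLp)).1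
  rw [Matrix.sub_mulVec, Matrix.smul_mulVec, Matrix.one_mulVec, dotProduct_sub, dotProduct_smul,
    star_dotProduct_self_eq_norm_sq, ← Matrix.mulVec_mulVec, Matrix.dotProduct_mulVec,
    ← Matrix.star_mulVec, star_dotProduct_self_eq_norm_sq, map_sub, smul_eq_mul,
    ← RCLike.ofReal_mul, RCLike.ofReal_re, RCLike.ofReal_re, sub_nonneg, ← mul_pow] at h1
  exact le_of_sq_le_sq h1 (by positivity)

theorem norm_le_of_posSemidef_smul_one_sub {A : Matrix ι ι 𝕜} (hA : A.PosSemidef) {r : ℝ}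
    (hr : 0 ≤ r) (h : ((r : 𝕜) • (1 : Matrix ι ι 𝕜) - A).PosSemidef) : ‖A‖ ≤ r := by
  obtain ⟨B, hB⟩ : ∃ B : Matrix ι ι 𝕜, A = Bᴴ * B := by
    obtain ⟨a, -, -, ha, -, -, -, -, -, -, -, haa⟩ := exists_sqrt_inverse_kernel hA
    exact ⟨a, by rw [ha.1.eq, haa]⟩
  subst hB
  rw [Matrix.l2_opNorm_conjTranspose_mul_self]
  have : ‖B‖ ≤ √r := norm_le_of_posSemidef_sub_conjTranspose_mul_self (Real.sqrt_nonneg r)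
    (by rwa [Real.sq_sqrt hr])
  calc ‖B‖ * ‖B‖ ≤ √r * √r := by gcongr
    _ = r := Real.mul_self_sqrt hr

/-- For `r > 0`, the norm bound `‖A‖ ≤ r` is positivity of the matrix `[r, A; A^*, r]`. -/
theorem posSemidef_fromBlocks_iff_norm_le (A : Matrix ι κ 𝕜) {r : ℝ} (hr : 0 < r) :
    (Matrix.fromBlocks ((r : 𝕜) • (1 : Matrix ι ι 𝕜)) A Aᴴ
      ((r : 𝕜) • (1 : Matrix κ κ 𝕜))).PosSemidef ↔ ‖A‖ ≤ r := by
  have hr' : (0 : 𝕜) < (r : 𝕜) := by exact_mod_cast hr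
  have hpd : ((r : 𝕜) • (1 : Matrix ι ι 𝕜)).PosDef := Matrix.PosDef.one.smul hr'
  have : Invertible ((r : 𝕜) • (1 : Matrix ι ι 𝕜)) := hpd.isUnit.invertible
  rw [Matrix.PosDef.fromBlocks₁₁ A _ hpd]
  have hinv : ((r : 𝕜) • (1 : Matrix ι ι 𝕜))⁻¹ = (r : 𝕜)⁻¹ • 1 := by
    refine Matrix.inv_eq_left_inv ?_
    rw [smul_mul_smul_comm, inv_mul_cancel₀ hr'.ne', one_smul, one_mul]
  have hsc : ((r ^ 2 : ℝ) : 𝕜) • (1 : Matrix κ κ 𝕜) - Aᴴ * A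
      = (r : 𝕜) • ((r : 𝕜) • (1 : Matrix κ κ 𝕜) - Aᴴ * ((r : 𝕜) • (1 : Matrix ι ι 𝕜))⁻¹ * A) := by
    rw [hinv, smul_sub, smul_smul]
    simp [smul_smul, hr'.ne', pow_two]
  constructor
  · intro h
    refine norm_le_of_posSemidef_sub_conjTranspose_mul_self hr.le ?_
    rw [hsc]
    exact h.smul hr'.le
  · intro h
    have h1 : (((r ^ 2 : ℝ) : 𝕜) • (1 : Matrix κ κ 𝕜) - Aᴴ * A).PosSemidef := by
      refine posSemidef_smul_one_sub (Matrix.isHermitian_conjTranspose_mul_self A) ?_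
      rw [Matrix.l2_opNorm_conjTranspose_mul_self, pow_two]
      gcongr
    rw [hsc] at h1
    have h2 := h1.smul (inv_nonneg.mpr hr'.le)
    rwa [smul_smul, inv_mul_cancel₀ hr'.ne', one_smul] at h2

end ScalarMatrices

/-! ### Bimodule actions of rectangular scalar matrices -/

section Bimodule

variable {𝕜 : Type*} [RCLike 𝕜] {E : Type*} [AddCommGroup E] [Module 𝕜 E]
  {ι ι' κ κ' μ μ' : Type*} [Fintype κ] [Fintype κ'] [Fintype μ] [Fintype μ']

/-- The product `a x b` of a matrix over `E` with scalar matrices, for arbitrary index types and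
shapes; `sandwich` is the special case of square matrices over `Fin n`. -/
def bimul (a : Matrix ι κ 𝕜) (x : Matrix κ κ' E) (b : Matrix κ' ι' 𝕜) : Matrix ι ι' E :=
  Matrix.of fun i j => ∑ k, ∑ l, (a i k * b l j) • x k l

theorem bimul_apply (a : Matrix ι κ 𝕜) (x : Matrix κ κ' E) (b : Matrix κ' ι' 𝕜) (i : ι) (j : ι') :
    bimul a x b i j = ∑ k, ∑ l, (a i k * b l j) • x k l := rfl

theorem sandwich_eq_bimul {m n : ℕ} (a : Matrix (Fin m) (Fin n) 𝕜) (x : Matrix (Fin n) (Fin n) E)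
    (b : Matrix (Fin n) (Fin m) 𝕜) : sandwich a x b = bimul a x b := rfl

theorem bimul_add (a : Matrix ι κ 𝕜) (x y : Matrix κ κ' E) (b : Matrix κ' ι' 𝕜) :
    bimul a (x + y) b = bimul a x b + bimul a y b := by
  ext i j
  simp [bimul_apply, Finset.sum_add_distrib]

theorem add_bimul (a a' : Matrix ι κ 𝕜) (x : Matrix κ κ' E) (b : Matrix κ' ι' 𝕜) :
    bimul (a + a') x b = bimul a x b + bimul a' x b := by
  ext i j
  simp [bimul_apply, Finset.sum_add_distrib, add_mul, add_smul]

theorem bimul_add' (a : Matrix ι κ 𝕜) (x : Matrix κ κ' E) (b b' : Matrix κ' ι' 𝕜) :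
    bimul a x (b + b') = bimul a x b + bimul a x b' := by
  ext i j
  simp [bimul_apply, Finset.sum_add_distrib, mul_add, add_smul]

theorem smul_bimul (c : 𝕜) (a : Matrix ι κ 𝕜) (x : Matrix κ κ' E) (b : Matrix κ' ι' 𝕜) :
    bimul (c • a) x b = c • bimul a x b := by
  ext i j
  simp [bimul_apply, Finset.smul_sum, smul_smul, mul_assoc]

theorem bimul_smul' (c : 𝕜) (a : Matrix ι κ 𝕜) (x : Matrix κ κ' E) (b : Matrix κ' ι' 𝕜) :
    bimul a x (c • b) = c • bimul a x b := by
  ext i j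
  simp [bimul_apply, Finset.smul_sum, smul_smul, mul_left_comm]

@[simp]
theorem zero_bimul (x : Matrix κ κ' E) (b : Matrix κ' ι' 𝕜) :
    bimul (0 : Matrix ι κ 𝕜) x b = 0 := by
  ext i j
  simp [bimul_apply]

@[simp]
theorem bimul_zero' (a : Matrix ι κ 𝕜) (x : Matrix κ κ' E) :
    bimul a x (0 : Matrix κ' ι' 𝕜) = 0 := by
  ext i j
  simp [bimul_apply]

theorem neg_bimul (a : Matrix ι κ 𝕜) (x : Matrix κ κ' E) (b : Matrix κ' ι' 𝕜) :
    bimul (-a) x b = -bimul a x b := by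
  ext i j
  simp [bimul_apply]

theorem bimul_neg' (a : Matrix ι κ 𝕜) (x : Matrix κ κ' E) (b : Matrix κ' ι' 𝕜) :
    bimul a x (-b) = -bimul a x b := by
  ext i j
  simp [bimul_apply]

@[simp]
theorem one_bimul_one [DecidableEq κ] [DecidableEq κ'] (x : Matrix κ κ' E) :
    bimul (1 : Matrix κ κ 𝕜) x (1 : Matrix κ' κ' 𝕜) = x := by
  ext i j
  rw [bimul_apply, Finset.sum_eq_single i, Finset.sum_eq_single j]
  · simp
  · intro l _ hl
    simp [Matrix.one_apply_ne hl]
  · simp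
  · intro k _ hk
    simp [Matrix.one_apply_ne hk.symm]
  · simp

theorem bimul_bimul (a : Matrix ι μ 𝕜) (b : Matrix μ κ 𝕜) (x : Matrix κ κ' E)
    (c : Matrix κ' μ' 𝕜) (d : Matrix μ' ι' 𝕜) :
    bimul a (bimul b x c) d = bimul (a * b) x (c * d) := by
  ext i j
  simp only [bimul_apply, Matrix.mul_apply, Finset.smul_sum, Finset.sum_mul_sum, Finset.sum_smul,
    smul_smul]
  rw [Finset.sum_congr rfl fun p _ => Finset.sum_comm, Finset.sum_comm]
  refine Finset.sum_congr rfl fun k _ => ?_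
  rw [Finset.sum_congr rfl fun p _ => Finset.sum_comm, Finset.sum_comm]
  refine Finset.sum_congr rfl fun l _ => Finset.sum_congr rfl fun p _ =>
    Finset.sum_congr rfl fun q _ => ?_
  congr 1
  ring

theorem bimul_fromCols_fromRows (p : Matrix ι κ 𝕜) (q : Matrix ι μ 𝕜) (x₁₁ : Matrix κ κ' E)
    (x₁₂ : Matrix κ μ' E) (x₂₁ : Matrix μ κ' E) (x₂₂ : Matrix μ μ' E)
    (r : Matrix κ' ι' 𝕜) (s : Matrix μ' ι' 𝕜) :
    bimul (Matrix.fromCols p q) (Matrix.fromBlocks x₁₁ x₁₂ x₂₁ x₂₂) (Matrix.fromRows r s)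
      = bimul p x₁₁ r + bimul p x₁₂ s + (bimul q x₂₁ r + bimul q x₂₂ s) := by
  ext i j
  simp only [bimul_apply, Fintype.sum_sum_type, Finset.sum_add_distrib, Matrix.fromCols_apply_inl,
    Matrix.fromCols_apply_inr, Matrix.fromRows_apply_inl, Matrix.fromRows_apply_inr,
    Matrix.fromBlocks_apply₁₁, Matrix.fromBlocks_apply₁₂, Matrix.fromBlocks_apply₂₁,
    Matrix.fromBlocks_apply₂₂, Matrix.add_apply]
  abel

theorem bimul_fromRows_fromCols {ι₁ ι₂ ι₃ ι₄ : Type*} (p : Matrix ι₁ κ 𝕜) (q : Matrix ι₂ κ 𝕜)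
    (x : Matrix κ κ' E) (r : Matrix κ' ι₃ 𝕜) (s : Matrix κ' ι₄ 𝕜) :
    bimul (Matrix.fromRows p q) x (Matrix.fromCols r s)
      = Matrix.fromBlocks (bimul p x r) (bimul p x s) (bimul q x r) (bimul q x s) := by
  ext i j
  rcases i with i | i <;> rcases j with j | j <;> simp [bimul_apply]

theorem bimul_diag_blocks {ι₁ ι₂ ι₃ ι₄ : Type*} (a : Matrix ι₁ κ 𝕜) (d : Matrix ι₂ μ 𝕜)
    (x₁₁ : Matrix κ κ' E) (x₁₂ : Matrix κ μ' E) (x₂₁ : Matrix μ κ' E) (x₂₂ : Matrix μ μ' E)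
    (a' : Matrix κ' ι₃ 𝕜) (d' : Matrix μ' ι₄ 𝕜) :
    bimul (Matrix.fromBlocks a 0 0 d) (Matrix.fromBlocks x₁₁ x₁₂ x₂₁ x₂₂)
        (Matrix.fromBlocks a' 0 0 d')
      = Matrix.fromBlocks (bimul a x₁₁ a') (bimul a x₁₂ d') (bimul d x₂₁ a') (bimul d x₂₂ d') := by
  ext i j
  rcases i with i | i <;> rcases j with j | j <;> simp [bimul_apply, Fintype.sum_sum_type]

theorem conjTranspose_bimul [StarAddMonoid E] [StarModule 𝕜 E] (a : Matrix ι κ 𝕜)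
    (x : Matrix κ κ' E) (b : Matrix κ' ι' 𝕜) : (bimul a x b)ᴴ = bimul bᴴ xᴴ aᴴ := by
  ext i j
  simp only [bimul_apply, Matrix.conjTranspose_apply, star_sum, star_smul, star_mul']
  rw [Finset.sum_comm]
  simp only [mul_comm]

theorem map_bimul (f : E →ₗ[𝕜] 𝕜) (a : Matrix ι κ 𝕜) (x : Matrix κ κ' E) (b : Matrix κ' ι' 𝕜) :
    (bimul a x b).map f = a * x.map f * b := by
  ext i j
  simp only [bimul_apply, Matrix.map_apply, map_sum, map_smul, Matrix.mul_apply, Finset.sum_mul,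
    smul_eq_mul]
  rw [Finset.sum_comm]
  refine Finset.sum_congr rfl fun l _ => Finset.sum_congr rfl fun k _ => ?_
  ring

/-- The `0`-`1` matrix of a map of index sets; it implements `Matrix.submatrix`. -/
def selectMatrix (𝕜 : Type*) [RCLike 𝕜] [DecidableEq κ] (e : ι → κ) : Matrix ι κ 𝕜 :=
  Matrix.of fun i k => if e i = k then 1 else 0

theorem submatrix_eq_bimul [DecidableEq κ] [DecidableEq κ'] (x : Matrix κ κ' E) (e : ι → κ)
    (e' : ι' → κ') :
    x.submatrix e e' = bimul (selectMatrix 𝕜 e) x (selectMatrix 𝕜 e')ᴴ := by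
  ext i j
  rw [bimul_apply, Finset.sum_eq_single (e i), Finset.sum_eq_single (e' j)]
  · simp [selectMatrix]
  · intro l _ hl
    simp [selectMatrix, hl.symm]
  · simp
  · intro k _ hk
    simp [selectMatrix, hk.symm]
  · simp

theorem selectMatrix_mul_conjTranspose [DecidableEq κ] [DecidableEq ι] {e : ι → κ}
    (he : Function.Injective e) : selectMatrix 𝕜 e * (selectMatrix 𝕜 e)ᴴ = 1 := by
  ext i j
  simp [selectMatrix, Matrix.mul_apply, Matrix.one_apply, he.eq_iff, eq_comm]

end Bimodule

/-! ### Positivity of matrices with arbitrary index types -/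

section Positivity

variable {𝕜 : Type*} [RCLike 𝕜] {E : Type*} [AddCommGroup E] [Module 𝕜 E]
  {C : ∀ n : ℕ, Set (Matrix (Fin n) (Fin n) E)}
  {ι κ μ : Type*} [Fintype ι] [Fintype κ] [Fintype μ]

variable (𝕜) in
/-- The cone `M_ι(E)_+` for an arbitrary finite index type `ι`: all compressions to `M_n(E)` are
positive. It extends the given cones by `isPos_fin_iff`. -/
def IsPos (C : ∀ n : ℕ, Set (Matrix (Fin n) (Fin n) E)) (x : Matrix ι ι E) : Prop :=
  ∀ (n : ℕ) (a : Matrix ι (Fin n) 𝕜), bimul aᴴ x a ∈ C n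

theorem IsPos.bimul {x : Matrix ι ι E} (hx : IsPos 𝕜 C x) (a : Matrix ι κ 𝕜) :
    IsPos 𝕜 C (bimul aᴴ x a) := by
  intro n b
  rw [bimul_bimul, ← Matrix.conjTranspose_mul]
  exact hx n _

theorem IsPos.bimul' {x : Matrix ι ι E} (hx : IsPos 𝕜 C x) (a : Matrix κ ι 𝕜) :
    IsPos 𝕜 C (NcBase.bimul a x aᴴ) := by
  simpa using hx.bimul aᴴ

theorem IsPos.submatrix [DecidableEq ι] {x : Matrix ι ι E} (hx : IsPos 𝕜 C x) (e : κ → ι) :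
    IsPos 𝕜 C (x.submatrix e e) := by
  rw [submatrix_eq_bimul (𝕜 := 𝕜)]
  exact hx.bimul' _

theorem isPos_submatrix_equiv [DecidableEq ι] [DecidableEq κ] {x : Matrix ι ι E} (e : κ ≃ ι) :
    IsPos 𝕜 C (x.submatrix e e) ↔ IsPos 𝕜 C x :=
  ⟨fun h => by simpa using h.submatrix e.symm, fun h => h.submatrix e⟩

theorem IsPos.fromBlocks₁₁ {p : Matrix ι ι E} {u : Matrix ι κ E} {v : Matrix κ ι E}
    {q : Matrix κ κ E} (h : IsPos 𝕜 C (Matrix.fromBlocks p u v q)) : IsPos 𝕜 C p := by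
  classical
  exact h.submatrix Sum.inl

theorem IsPos.fromBlocks₂₂ {p : Matrix ι ι E} {u : Matrix ι κ E} {v : Matrix κ ι E}
    {q : Matrix κ κ E} (h : IsPos 𝕜 C (Matrix.fromBlocks p u v q)) : IsPos 𝕜 C q := by
  classical
  exact h.submatrix Sum.inr

theorem IsPos.fromBlocks_swap {p : Matrix ι ι E} {u : Matrix ι κ E} {v : Matrix κ ι E}
    {q : Matrix κ κ E} (h : IsPos 𝕜 C (Matrix.fromBlocks p u v q)) :
    IsPos 𝕜 C (Matrix.fromBlocks q v u p) := by
  classical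
  have := h.submatrix (Equiv.sumComm κ ι)
  simpa using this

/-- Conjugation of a positive `2 × 2` block matrix by a block diagonal scalar matrix. -/
theorem IsPos.fromBlocks_conj {p : Matrix ι ι E} {u : Matrix ι κ E} {v : Matrix κ ι E}
    {q : Matrix κ κ E} (h : IsPos 𝕜 C (Matrix.fromBlocks p u v q)) {ι' κ' : Type*} [Fintype ι']
    [Fintype κ'] (a : Matrix ι' ι 𝕜) (d : Matrix κ' κ 𝕜) :
    IsPos 𝕜 C (Matrix.fromBlocks (NcBase.bimul a p aᴴ) (NcBase.bimul a u dᴴ)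
      (NcBase.bimul d v aᴴ) (NcBase.bimul d q dᴴ)) := by
  have := h.bimul' (Matrix.fromBlocks a 0 0 d)
  rwa [Matrix.fromBlocks_conjTranspose, Matrix.conjTranspose_zero, Matrix.conjTranspose_zero,
    bimul_diag_blocks] at this

theorem IsPos.fromBlocks_neg {p : Matrix ι ι E} {u : Matrix ι κ E} {v : Matrix κ ι E}
    {q : Matrix κ κ E} (h : IsPos 𝕜 C (Matrix.fromBlocks p u v q)) :
    IsPos 𝕜 C (Matrix.fromBlocks p (-u) (-v) q) := by
  classical
  simpa [bimul_neg', neg_bimul] using h.fromBlocks_conj (1 : Matrix ι ι 𝕜) (-1 : Matrix κ κ 𝕜)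

variable [StarAddMonoid E] [StarModule 𝕜 E]

theorem isPos_fin_iff (hC : IsMatrixOrdered 𝕜 C) {n : ℕ} {x : Matrix (Fin n) (Fin n) E} :
    IsPos 𝕜 C x ↔ x ∈ C n :=
  ⟨fun h => by simpa using h n 1, fun h m a => hC.compress n m a x h⟩

theorem isPos_blocks_iff (hC : IsMatrixOrdered 𝕜 C) {m n : ℕ} {a : Matrix (Fin m) (Fin m) E}
    {b : Matrix (Fin m) (Fin n) E} {c : Matrix (Fin n) (Fin m) E} {d : Matrix (Fin n) (Fin n) E} :
    blocks a b c d ∈ C (m + n) ↔ IsPos 𝕜 C (Matrix.fromBlocks a b c d) := by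
  rw [← isPos_fin_iff hC]
  exact isPos_submatrix_equiv finSumFinEquiv.symm

theorem IsPos.add (hC : IsMatrixOrdered 𝕜 C) {x y : Matrix ι ι E} (hx : IsPos 𝕜 C x)
    (hy : IsPos 𝕜 C y) : IsPos 𝕜 C (x + y) := by
  intro n a
  rw [bimul_add]
  exact hC.add_mem n _ (hx n a) _ (hy n a)

theorem IsPos.conjTranspose_eq (hC : IsMatrixOrdered 𝕜 C) {x : Matrix ι ι E}
    (hx : IsPos 𝕜 C x) : xᴴ = x := by
  classical
  let e := (Fintype.equivFin ι).symm
  have h := hC.selfadjoint _ _ ((isPos_fin_iff hC).mp (hx.submatrix e))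
  rw [Matrix.conjTranspose_submatrix] at h
  ext i j
  simpa using congrFun (congrFun h (e.symm i)) (e.symm j)

theorem IsPos.fromBlocks_diagonal (hC : IsMatrixOrdered 𝕜 C) {p : Matrix ι ι E} {q : Matrix κ κ E}
    (hp : IsPos 𝕜 C p) (hq : IsPos 𝕜 C q) : IsPos 𝕜 C (Matrix.fromBlocks p 0 0 q) := by
  classical
  have h1 := hp.bimul' (Matrix.fromRows (1 : Matrix ι ι 𝕜) (0 : Matrix κ ι 𝕜))
  have h2 := hq.bimul' (Matrix.fromRows (0 : Matrix ι κ 𝕜) (1 : Matrix κ κ 𝕜))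
  rw [Matrix.conjTranspose_fromRows_eq_fromCols_conjTranspose, bimul_fromRows_fromCols] at h1 h2
  simpa [Matrix.fromBlocks_add] using h1.add hC h2

/-- A selfadjoint functional that is positive on `E_+` is completely positive. -/
theorem IsPos.map_posSemidef {f : E →ₗ[𝕜] 𝕜} (hf : IsSelfadjointFunctional f)
    (hC : IsMatrixOrdered 𝕜 C)
    (hpos : ∀ x, single x ∈ C 1 → 0 ≤ f x) {x : Matrix ι ι E} (hx : IsPos 𝕜 C x) :
    (x.map f).PosSemidef := by
  refine Matrix.PosSemidef.of_dotProduct_mulVec_nonneg ?_ fun v => ?_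
  · ext i j
    rw [Matrix.conjTranspose_apply, Matrix.map_apply, Matrix.map_apply, ← hf,
      ← Matrix.conjTranspose_apply, hx.conjTranspose_eq hC]
  · let a : Matrix ι (Fin 1) 𝕜 := Matrix.of fun i _ => v i
    have h1 := hpos (NcBase.bimul aᴴ x a 0 0) (by
      convert hx 1 a using 1
      ext i j
      rw [Subsingleton.elim i 0, Subsingleton.elim j 0]
      rfl)
    have h2 := congrFun (congrFun (map_bimul f aᴴ x a) 0) 0
    rw [Matrix.map_apply] at h2
    rw [h2] at h1
    convert h1 using 1
    rw [Matrix.mul_assoc]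
    rfl

end Positivity

/-! ### The nc base norm of a matrix base ordered space -/

section ScalarCompress

variable {𝕜 : Type*} [RCLike 𝕜] {ι κ : Type*} [Fintype ι] [Fintype κ]
  [DecidableEq ι] [DecidableEq κ]

theorem posSemidef_smul_one_sub_conj {M : Matrix ι ι 𝕜} {r s : ℝ} (hr : 0 ≤ r)
    (h : ((r : 𝕜) • (1 : Matrix ι ι 𝕜) - M).PosSemidef) (a : Matrix κ ι 𝕜) (ha : ‖a‖ ≤ s) :
    (((s * s * r : ℝ) : 𝕜) • (1 : Matrix κ κ 𝕜) - a * M * aᴴ).PosSemidef := by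
  have h1 := h.mul_mul_conjTranspose_same a
  have h2 : (((s * s : ℝ) : 𝕜) • (1 : Matrix κ κ 𝕜) - a * aᴴ).PosSemidef := by
    refine posSemidef_smul_one_sub (Matrix.isHermitian_mul_conjTranspose_self a) ?_
    have := Matrix.l2_opNorm_conjTranspose_mul_self aᴴ
    rw [Matrix.conjTranspose_conjTranspose, Matrix.l2_opNorm_conjTranspose] at this
    rw [this]
    gcongr
    exact (norm_nonneg a).trans ha
  have h3 := h1.add (h2.smul (RCLike.ofReal_nonneg.mpr hr : (0 : 𝕜) ≤ (r : 𝕜)))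
  convert h3 using 1
  rw [Matrix.mul_sub, Matrix.sub_mul, smul_sub, Matrix.mul_smul, Matrix.smul_mul, Matrix.mul_one,
    smul_smul]
  push_cast
  rw [mul_comm (r : 𝕜)]
  abel

theorem posSemidef_fromBlocks_diagonal {p : Matrix ι ι 𝕜} {q : Matrix κ κ 𝕜} (hp : p.PosSemidef)
    (hq : q.PosSemidef) : (Matrix.fromBlocks p 0 0 q).PosSemidef := by
  have h1 := hp.mul_mul_conjTranspose_same (Matrix.fromRows (1 : Matrix ι ι 𝕜) (0 : Matrix κ ι 𝕜))
  have h2 := hq.mul_mul_conjTranspose_same (Matrix.fromRows (0 : Matrix ι κ 𝕜) (1 : Matrix κ κ 𝕜))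
  rw [Matrix.conjTranspose_fromRows_eq_fromCols_conjTranspose, Matrix.fromRows_mul,
    Matrix.fromRows_mul_fromCols] at h1 h2
  simpa [Matrix.fromBlocks_add] using h1.add h2

end ScalarCompress

section Blocks

variable {E : Type*}

theorem blocks_apply {m n : ℕ} [AddCommGroup E] (a : Matrix (Fin m) (Fin m) E)
    (b : Matrix (Fin m) (Fin n) E)
    (c : Matrix (Fin n) (Fin m) E) (d : Matrix (Fin n) (Fin n) E) (i j : Fin m ⊕ Fin n) :
    blocks a b c d (finSumFinEquiv i) (finSumFinEquiv j) = Matrix.fromBlocks a b c d i j := by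
  simp only [blocks, Matrix.reindex_apply, Matrix.submatrix_apply, Equiv.symm_apply_apply]

theorem ext_finSumFinEquiv {m n : ℕ} {x y : Matrix (Fin (m + n)) (Fin (m + n)) E}
    (h : ∀ i j : Fin m ⊕ Fin n, x (finSumFinEquiv i) (finSumFinEquiv j)
      = y (finSumFinEquiv i) (finSumFinEquiv j)) : x = y := by
  ext i j
  obtain ⟨i, rfl⟩ := finSumFinEquiv.surjective i
  obtain ⟨j, rfl⟩ := finSumFinEquiv.surjective j
  exact h i j

end Blocks

section BaseNorm

set_option linter.unusedSectionVars false

variable {𝕜 : Type*} [RCLike 𝕜] {E : Type*} [AddCommGroup E] [Module 𝕜 E]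
  [StarAddMonoid E] [StarModule 𝕜 E]
  {C : ∀ n : ℕ, Set (Matrix (Fin n) (Fin n) E)} {f : E →ₗ[𝕜] 𝕜}
  {ι κ ι' κ' : Type*} [Fintype ι] [Fintype κ] [DecidableEq ι] [DecidableEq κ]
  [Fintype ι'] [Fintype κ'] [DecidableEq ι'] [DecidableEq κ']

omit [StarModule 𝕜 E] in
variable (C f) in
/-- The relation `‖u‖ ≤ r` for the nc base norm, witnessed by a positive matrix `[p, u; u^*, q]`
with `f(p), f(q) ≤ r`. -/
def BaseBound (r : ℝ) (u : Matrix ι κ E) : Prop :=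
  ∃ p q, IsPos 𝕜 C (Matrix.fromBlocks p u uᴴ q) ∧
    ((r : 𝕜) • (1 : Matrix ι ι 𝕜) - p.map f).PosSemidef ∧
    ((r : 𝕜) • (1 : Matrix κ κ 𝕜) - q.map f).PosSemidef

theorem BaseBound.bimul {r s : ℝ} {u : Matrix ι κ E} (h : BaseBound C f r u) (hr : 0 ≤ r)
    {a : Matrix ι' ι 𝕜} {b : Matrix κ κ' 𝕜} (ha : ‖a‖ ≤ s) (hb : ‖b‖ ≤ s) :
    BaseBound C f (s * s * r) (NcBase.bimul a u b) := by
  obtain ⟨p, q, h, hp, hq⟩ := h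
  refine ⟨NcBase.bimul a p aᴴ, NcBase.bimul bᴴ q bᴴᴴ, ?_, ?_, ?_⟩
  · have := h.fromBlocks_conj a bᴴ
    rwa [conjTranspose_bimul, ← Matrix.conjTranspose_conjTranspose b,
      Matrix.conjTranspose_conjTranspose bᴴ]
  · rw [map_bimul]
    exact posSemidef_smul_one_sub_conj hr hp a ha
  · rw [map_bimul]
    exact posSemidef_smul_one_sub_conj hr hq bᴴ (by rwa [Matrix.l2_opNorm_conjTranspose])

theorem BaseBound.mono {r s : ℝ} {u : Matrix ι κ E} (h : BaseBound C f r u) (hrs : r ≤ s) :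
    BaseBound C f s u := by
  obtain ⟨p, q, h, hp, hq⟩ := h
  have hs : (0 : 𝕜) ≤ ((s - r : ℝ) : 𝕜) := RCLike.ofReal_nonneg.mpr (sub_nonneg.mpr hrs)
  refine ⟨p, q, h, ?_, ?_⟩
  · convert hp.add (Matrix.PosSemidef.one.smul hs) using 1
    push_cast
    rw [sub_smul]
    abel
  · convert hq.add (Matrix.PosSemidef.one.smul hs) using 1
    push_cast
    rw [sub_smul]
    abel

theorem BaseBound.add (hC : IsMatrixOrdered 𝕜 C) {r s : ℝ} {u v : Matrix ι κ E}
    (hu : BaseBound C f r u) (hv : BaseBound C f s v) : BaseBound C f (r + s) (u + v) := by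
  obtain ⟨p, q, h, hp, hq⟩ := hu
  obtain ⟨p', q', h', hp', hq'⟩ := hv
  refine ⟨p + p', q + q', ?_, ?_, ?_⟩
  · simpa [Matrix.fromBlocks_add] using h.add hC h'
  · convert hp.add hp' using 1
    rw [Matrix.map_add _ (map_add f)]
    push_cast
    rw [add_smul]
    abel
  · convert hq.add hq' using 1
    rw [Matrix.map_add _ (map_add f)]
    push_cast
    rw [add_smul]
    abel

omit [StarModule 𝕜 E] in
theorem BaseBound.conjTranspose {r : ℝ} {u : Matrix ι κ E} (h : BaseBound C f r u) :
    BaseBound C f r uᴴ := by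
  obtain ⟨p, q, h, hp, hq⟩ := h
  exact ⟨q, p, by simpa using h.fromBlocks_swap, hq, hp⟩

theorem BaseBound.submatrix {r : ℝ} {u : Matrix ι κ E} (h : BaseBound C f r u) {e : ι' → ι}
    (he : Function.Injective e) {e' : κ' → κ} (he' : Function.Injective e') :
    BaseBound C f r (u.submatrix e e') := by
  obtain ⟨p, q, h, hp, hq⟩ := h
  refine ⟨p.submatrix e e, q.submatrix e' e', ?_, ?_, ?_⟩
  · have h1 := h.submatrix (Sum.map e e')
    convert h1 using 1
    ext i j
    rcases i with i | i <;> rcases j with j | j <;> rfl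
  · convert hp.submatrix e using 1
    ext i j
    simp [Matrix.one_apply, he.eq_iff]
  · convert hq.submatrix e' using 1
    ext i j
    simp [Matrix.one_apply, he'.eq_iff]

/-- A direct sum satisfies the bound that its summands satisfy. -/
theorem BaseBound.blocks (hC : IsMatrixOrdered 𝕜 C) {r : ℝ} {m n : ℕ}
    {u : Matrix (Fin m) (Fin m) E} {v : Matrix (Fin n) (Fin n) E}
    (hu : BaseBound C f r u) (hv : BaseBound C f r v) :
    BaseBound C f r (NcBase.blocks u 0 0 v) := by
  obtain ⟨p, q, h, hp, hq⟩ := hu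
  obtain ⟨p', q', h', hp', hq'⟩ := hv
  have hd : ∀ {p : Matrix (Fin m) (Fin m) E} {p' : Matrix (Fin n) (Fin n) E},
      ((r : 𝕜) • (1 : Matrix (Fin m) (Fin m) 𝕜) - p.map f).PosSemidef →
      ((r : 𝕜) • (1 : Matrix (Fin n) (Fin n) 𝕜) - p'.map f).PosSemidef →
      ((r : 𝕜) • (1 : Matrix (Fin (m + n)) (Fin (m + n)) 𝕜)
        - (NcBase.blocks p 0 0 p').map f).PosSemidef := by
    intro p p' hp hp'
    convert (posSemidef_fromBlocks_diagonal hp hp').submatrix finSumFinEquiv.symm using 1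
    refine ext_finSumFinEquiv fun i j => ?_
    rcases i with i | i <;> rcases j with j | j <;>
      simp only [Matrix.sub_apply, Matrix.smul_apply, Matrix.one_apply, Matrix.map_apply,
        blocks_apply, Matrix.submatrix_apply, Equiv.symm_apply_apply,
        EmbeddingLike.apply_eq_iff_eq, Matrix.fromBlocks_apply₁₁, Matrix.fromBlocks_apply₁₂,
        Matrix.fromBlocks_apply₂₁, Matrix.fromBlocks_apply₂₂, Sum.inl.injEq, Sum.inr.injEq,
        reduceCtorEq, if_false, Matrix.zero_apply, map_zero, smul_zero, sub_zero]
  refine ⟨NcBase.blocks p 0 0 p', NcBase.blocks q 0 0 q', ?_, hd hp hp', hd hq hq'⟩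
  have hsum := (h.fromBlocks_diagonal hC h').submatrix
    (Sum.elim (fun i => (finSumFinEquiv.symm i).map Sum.inl Sum.inl)
      (fun i => (finSumFinEquiv.symm i).map Sum.inr Sum.inr) :
      Fin (m + n) ⊕ Fin (m + n) → (Fin m ⊕ Fin m) ⊕ (Fin n ⊕ Fin n))
  convert hsum using 1
  ext i j
  rcases i with i | i <;> rcases j with j | j <;>
    obtain ⟨i, rfl⟩ := finSumFinEquiv.surjective i <;>
    obtain ⟨j, rfl⟩ := finSumFinEquiv.surjective j <;>
    rcases i with i | i <;> rcases j with j | j <;> simp [NcBase.blocks]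

theorem baseNormSa_bddBelow (n : ℕ) (u : Matrix (Fin n) (Fin n) E) :
    BddBelow {r | ∃ y ∈ C n, ∃ z ∈ C n, u = y - z ∧ r = ‖ampl f (y + z)‖} :=
  ⟨0, by rintro _ ⟨y, -, z, -, -, rfl⟩; exact norm_nonneg _⟩

theorem baseNormSa_nonneg (n : ℕ) (u : Matrix (Fin n) (Fin n) E) : 0 ≤ baseNormSa C f n u :=
  Real.sInf_nonneg (by rintro _ ⟨y, -, z, -, -, rfl⟩; exact norm_nonneg _)

theorem IsMatrixBaseOrdered.map_posSemidef {K : ∀ n : ℕ, Set (Matrix (Fin n) (Fin n) E)}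
    (hB : IsMatrixBaseOrdered C K f) {x : Matrix ι ι E}
    (hx : IsPos 𝕜 C x) : (x.map f).PosSemidef :=
  hx.map_posSemidef hB.selfadjoint hB.matrixOrdered hB.positive

variable {K : ∀ n : ℕ, Set (Matrix (Fin n) (Fin n) E)} (hB : IsMatrixBaseOrdered C K f)
include hB

theorem baseNormSa_sub_le {n : ℕ} {y z : Matrix (Fin n) (Fin n) E} (hy : y ∈ C n) (hz : z ∈ C n)
    {r : ℝ} (hr : 0 ≤ r)
    (h : ((r : 𝕜) • (1 : Matrix (Fin n) (Fin n) 𝕜) - ampl f (y + z)).PosSemidef) :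
    baseNormSa C f n (y - z) ≤ r := by
  refine csInf_le_of_le (baseNormSa_bddBelow n _) ⟨y, hy, z, hz, rfl, rfl⟩ ?_
  refine norm_le_of_posSemidef_smul_one_sub ?_ hr h
  exact hB.map_posSemidef
    ((isPos_fin_iff hB.matrixOrdered).mpr (hB.matrixOrdered.add_mem n y hy z hz))

/-- Selfadjoint elements are differences of positive ones since the base dominates them, so that
the infimum in `baseNormSa` is over a nonempty set. -/
theorem exists_of_baseNormSa_lt {n : ℕ} {u : Matrix (Fin n) (Fin n) E} (hu : uᴴ = u) {r : ℝ}
    (h : baseNormSa C f n u < r) :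
    ∃ y ∈ C n, ∃ z ∈ C n, u = y - z ∧
      ((r : 𝕜) • (1 : Matrix (Fin n) (Fin n) 𝕜) - ampl f (y + z)).PosSemidef := by
  have hC := hB.matrixOrdered
  obtain ⟨t, ht, k, hk, hd⟩ := hB.dominated n u hu
  rw [hB.base_eq] at hk
  have hne : {r | ∃ y ∈ C n, ∃ z ∈ C n, u = y - z ∧ r = ‖ampl f (y + z)‖}.Nonempty :=
    ⟨_, (t : 𝕜) • k, hC.smul_mem n t ht.le k hk.1, (t : 𝕜) • k - u, hd, by abel, rfl⟩
  obtain ⟨_, ⟨y, hy, z, hz, rfl, rfl⟩, hlt⟩ := exists_lt_of_csInf_lt hne h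
  refine ⟨y, hy, z, hz, rfl, posSemidef_smul_one_sub ?_ hlt.le⟩
  exact (hB.map_posSemidef ((isPos_fin_iff hC).mpr (hC.add_mem n y hy z hz))).1

theorem BaseBound.baseNorm_le {n : ℕ} {r : ℝ} (hr : 0 ≤ r) {u : Matrix (Fin n) (Fin n) E}
    (h : BaseBound C f r u) : baseNorm C f n u ≤ r := by
  obtain ⟨p, q, h, hp, hq⟩ := h
  have hC := hB.matrixOrdered
  have h2 : (0 : ℝ) ≤ 1 / 2 := by norm_num
  have hY := (isPos_blocks_iff hC).mpr h
  have hZ := (isPos_blocks_iff hC).mpr h.fromBlocks_neg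
  have hhalf : ((1 / 2 : ℝ) : 𝕜) + ((1 / 2 : ℝ) : 𝕜) = 1 := by
    rw [← RCLike.ofReal_add]
    norm_num
  have key := baseNormSa_sub_le hB (hC.smul_mem _ _ h2 _ hY) (hC.smul_mem _ _ h2 _ hZ) hr (by
    convert (posSemidef_fromBlocks_diagonal hp hq).submatrix finSumFinEquiv.symm using 1
    refine ext_finSumFinEquiv fun i j => ?_
    simp only [ampl, Matrix.sub_apply, Matrix.smul_apply, Matrix.one_apply, Matrix.map_apply,
      Matrix.add_apply, blocks_apply, Matrix.submatrix_apply, Equiv.symm_apply_apply,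
      EmbeddingLike.apply_eq_iff_eq]
    rcases i with i | i <;> rcases j with j | j <;>
      simp only [Matrix.fromBlocks_apply₁₁, Matrix.fromBlocks_apply₁₂, Matrix.fromBlocks_apply₂₁,
        Matrix.fromBlocks_apply₂₂, Sum.inl.injEq, Sum.inr.injEq, reduceCtorEq, if_false,
        Matrix.neg_apply, Matrix.zero_apply, smul_neg, add_neg_cancel, map_zero, smul_zero,
        sub_zero, ← add_smul, hhalf, one_smul, Matrix.sub_apply, Matrix.smul_apply,
        Matrix.one_apply, Matrix.map_apply])
  convert key using 1
  unfold baseNorm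
  congr 1
  refine ext_finSumFinEquiv fun i j => ?_
  simp only [tilde, Matrix.sub_apply, Matrix.smul_apply, blocks_apply]
  rcases i with i | i <;> rcases j with j | j <;>
    simp only [Matrix.fromBlocks_apply₁₁, Matrix.fromBlocks_apply₁₂, Matrix.fromBlocks_apply₂₁,
      Matrix.fromBlocks_apply₂₂, Matrix.neg_apply, Matrix.zero_apply, smul_neg, sub_neg_eq_add,
      sub_self, ← add_smul, hhalf, one_smul]

omit [StarModule 𝕜 E] [Module 𝕜 E] hB in
theorem conjTranspose_tilde {n : ℕ} (u : Matrix (Fin n) (Fin n) E) : (tilde u)ᴴ = tilde u := by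
  rw [tilde, blocks, Matrix.conjTranspose_reindex, Matrix.fromBlocks_conjTranspose]
  simp

/-- If `[0, u; u^*, 0] = y - z` with `y, z ≥ 0`, then changing the sign of the off-diagonal part
of `z` makes `y + z` a positive matrix with off-diagonal part `u`. -/
theorem baseBound_of_baseNorm_lt {n : ℕ} {r : ℝ} {u : Matrix (Fin n) (Fin n) E}
    (h : baseNorm C f n u < r) : BaseBound C f r u := by
  have hC := hB.matrixOrdered
  obtain ⟨y, hy, z, hz, hu, hr⟩ := exists_of_baseNormSa_lt hB (conjTranspose_tilde u) h
  have hy' := ((isPos_fin_iff hC).mpr hy).submatrix (finSumFinEquiv (m := n) (n := n))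
  have hz' := ((isPos_fin_iff hC).mpr hz).submatrix (finSumFinEquiv (m := n) (n := n))
  have hu' := congrArg (fun w => w.submatrix (finSumFinEquiv (m := n) (n := n)) finSumFinEquiv) hu
  simp only [tilde, blocks, Matrix.reindex_apply, Matrix.submatrix_submatrix, Matrix.submatrix_sub,
    Pi.sub_apply, Equiv.symm_comp_self, Matrix.submatrix_id_id] at hu'
  have hr' := hr.submatrix (finSumFinEquiv (m := n) (n := n))
  have h1 := hr'.submatrix (Sum.inl : Fin n → Fin n ⊕ Fin n)
  have h2 := hr'.submatrix (Sum.inr : Fin n → Fin n ⊕ Fin n)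
  generalize hY : y.submatrix finSumFinEquiv finSumFinEquiv = Y at *
  generalize hZ : z.submatrix finSumFinEquiv finSumFinEquiv = Z at *
  rw [← Matrix.fromBlocks_toBlocks Y] at hy'
  rw [← Matrix.fromBlocks_toBlocks Z] at hz'
  refine ⟨Y.toBlocks₁₁ + Z.toBlocks₁₁, Y.toBlocks₂₂ + Z.toBlocks₂₂, ?_, ?_, ?_⟩
  · have := hy'.add hC hz'.fromBlocks_neg
    rw [Matrix.fromBlocks_add] at this
    convert this using 2
    · rw [← Matrix.toBlocks_fromBlocks₁₂ 0 u uᴴ 0, hu', ← sub_eq_add_neg]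
      rfl
    · conv_lhs => rw [← Matrix.toBlocks_fromBlocks₂₁ 0 u uᴴ 0, hu']
      rw [← sub_eq_add_neg]
      rfl
  · convert h1 using 1
    ext i j
    simp [← hY, ← hZ, Matrix.toBlocks₁₁, ampl, Matrix.one_apply]
  · convert h2 using 1
    ext i j
    simp [← hY, ← hZ, Matrix.toBlocks₂₂, ampl, Matrix.one_apply]

theorem baseNorm_le_iff {n : ℕ} {r : ℝ} {u : Matrix (Fin n) (Fin n) E} :
    baseNorm C f n u ≤ r ↔ 0 ≤ r ∧ ∀ s, r < s → BaseBound C f s u := by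
  constructor
  · exact fun h => ⟨(baseNormSa_nonneg _ _).trans h,
      fun s hs => baseBound_of_baseNorm_lt hB (h.trans_lt hs)⟩
  · exact fun ⟨hr, h⟩ => le_of_forall_gt_imp_ge_of_dense fun s hs =>
      (h s hs).baseNorm_le hB (hr.trans hs.le)

theorem baseNorm_conjTranspose {n : ℕ} (u : Matrix (Fin n) (Fin n) E) :
    baseNorm C f n uᴴ = baseNorm C f n u := by
  refine le_antisymm ?_ ?_
  · exact (baseNorm_le_iff hB).mpr ⟨baseNormSa_nonneg _ _, fun s hs =>
      (baseBound_of_baseNorm_lt hB hs).conjTranspose⟩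
  · exact (baseNorm_le_iff hB).mpr ⟨baseNormSa_nonneg _ _, fun s hs => by
      simpa using (baseBound_of_baseNorm_lt hB hs).conjTranspose⟩

theorem baseNorm_bimul_le_of_norm_le {m n : ℕ} {s : ℝ} {a : Matrix (Fin m) (Fin n) 𝕜}
    {b : Matrix (Fin n) (Fin m) 𝕜} (ha : ‖a‖ ≤ s) (hb : ‖b‖ ≤ s) (u : Matrix (Fin n) (Fin n) E) :
    baseNorm C f m (bimul a u b) ≤ s * s * baseNorm C f n u := by
  have h0 : 0 ≤ baseNorm C f n u := baseNormSa_nonneg _ _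
  refine (baseNorm_le_iff hB).mpr ⟨mul_nonneg (mul_self_nonneg s) h0, fun r hr => ?_⟩
  obtain ⟨d, hd, hdr⟩ : ∃ d, baseNorm C f n u < d ∧ s * s * d ≤ r := by
    rcases (mul_self_nonneg s).eq_or_lt with hs | hs
    · exact ⟨_, lt_add_one _, by rw [← hs, zero_mul] at hr ⊢; exact hr.le⟩
    · exact ⟨r / (s * s), by rwa [lt_div_iff₀' hs], (mul_div_cancel₀ r hs.ne').le⟩
  exact ((baseBound_of_baseNorm_lt hB hd).bimul (h0.trans hd.le) ha hb).mono hdr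

theorem baseNorm_zero (n : ℕ) : baseNorm C f n (0 : Matrix (Fin n) (Fin n) E) = 0 := by
  refine le_antisymm ?_ (baseNormSa_nonneg _ _)
  have := baseNorm_bimul_le_of_norm_le hB (a := (0 : Matrix (Fin n) (Fin n) 𝕜))
    (b := (0 : Matrix (Fin n) (Fin n) 𝕜)) (s := 0) (by simp) (by simp) 0
  simpa using this

theorem baseNorm_bimul_le {m n : ℕ} (a : Matrix (Fin m) (Fin n) 𝕜)
    (u : Matrix (Fin n) (Fin n) E) (b : Matrix (Fin n) (Fin m) 𝕜) :
    baseNorm C f m (bimul a u b) ≤ ‖a‖ * baseNorm C f n u * ‖b‖ := by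
  rcases eq_or_ne a 0 with rfl | ha
  · simp [baseNorm_zero hB]
  rcases eq_or_ne b 0 with rfl | hb
  · simp [baseNorm_zero hB]
  have ha' : 0 < ‖a‖ := norm_pos_iff.mpr ha
  have hb' : 0 < ‖b‖ := norm_pos_iff.mpr hb
  -- Balance the two factors so that both have norm `√(‖a‖ ‖b‖)`.
  set c : ℝ := √(‖b‖ / ‖a‖) with hc
  have hc0 : 0 < c := Real.sqrt_pos.mpr (div_pos hb' ha')
  have hcc : c * c = ‖b‖ / ‖a‖ := Real.mul_self_sqrt (by positivity)
  have hcK : ((c : ℝ) : 𝕜) ≠ 0 := by exact_mod_cast hc0.ne'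
  have h1 : bimul a u b = bimul ((c : 𝕜) • a) u ((c : 𝕜)⁻¹ • b) := by
    rw [smul_bimul, bimul_smul', smul_smul, mul_inv_cancel₀ hcK, one_smul]
  have hna : ‖(c : 𝕜) • a‖ ≤ c * ‖a‖ := by
    rw [norm_smul, RCLike.norm_ofReal, abs_of_pos hc0]
  have hnb : ‖(c : 𝕜)⁻¹ • b‖ ≤ c * ‖a‖ := by
    rw [norm_smul, norm_inv, RCLike.norm_ofReal, abs_of_pos hc0, inv_mul_le_iff₀ hc0, ← mul_assoc,
      hcc, div_mul_cancel₀ _ ha'.ne']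
  rw [h1]
  refine (baseNorm_bimul_le_of_norm_le hB hna hnb u).trans_eq ?_
  calc c * ‖a‖ * (c * ‖a‖) * baseNorm C f n u = (c * c) * ‖a‖ * ‖a‖ * baseNorm C f n u := by ring
    _ = _ := by
      rw [hcc, div_mul_cancel₀ _ ha'.ne']
      ring

end BaseNorm

/-! ### Matrix base ordered spaces are nc base norm spaces -/

section MatrixBaseOrdered

set_option linter.unusedSectionVars false

variable {𝕜 : Type*} [RCLike 𝕜] {E : Type*} [AddCommGroup E] [Module 𝕜 E]
  [StarAddMonoid E] [StarModule 𝕜 E]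
  {C : ∀ n : ℕ, Set (Matrix (Fin n) (Fin n) E)} {f : E →ₗ[𝕜] 𝕜}
  {K : ∀ n : ℕ, Set (Matrix (Fin n) (Fin n) E)}

theorem ampl_sandwich {m n : ℕ} (a : Matrix (Fin m) (Fin n) 𝕜) (x : Matrix (Fin n) (Fin n) E)
    (b : Matrix (Fin n) (Fin m) 𝕜) : ampl f (sandwich a x b) = a * ampl f x * b :=
  map_bimul f a x b

theorem ampl_add {n : ℕ} (x y : Matrix (Fin n) (Fin n) E) :
    ampl f (x + y) = ampl f x + ampl f y :=
  Matrix.map_add _ (map_add f) x y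

theorem isMatrixConvex_baseOf (hC : IsMatrixOrdered 𝕜 C) : IsMatrixConvex 𝕜 (baseOf C f) where
  dsum m n x hx y hy := by
    refine ⟨(isPos_blocks_iff hC).mpr (((isPos_fin_iff hC).mpr hx.1).fromBlocks_diagonal hC
      ((isPos_fin_iff hC).mpr hy.1)), ?_⟩
    have h1 : x.map f = 1 := hx.2
    have h2 : y.map f = 1 := hy.2
    change (blocks x 0 0 y).map f = 1
    rw [blocks, Matrix.reindex_apply, ← Matrix.submatrix_map, Matrix.fromBlocks_map, h1, h2,
      Matrix.map_zero _ (map_zero f), Matrix.map_zero _ (map_zero f), Matrix.fromBlocks_one,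
      Matrix.submatrix_one_equiv]
  compress n m a ha x hx := by
    refine ⟨hC.compress n m a x hx.1, ?_⟩
    have h1 : ampl f x = 1 := hx.2
    change ampl f _ = 1
    rw [ampl_sandwich, h1, Matrix.mul_one, ha]

variable (hB : IsMatrixBaseOrdered C K f)
include hB

theorem ampl_posSemidef {n : ℕ} {x : Matrix (Fin n) (Fin n) E} (hx : x ∈ C n) :
    (ampl f x).PosSemidef :=
  hB.map_posSemidef ((isPos_fin_iff hB.matrixOrdered).mpr hx)

/-- On selfadjoint matrices the two formulas for the nc base norm agree. -/
theorem baseNorm_eq_baseNormSa {n : ℕ} {u : Matrix (Fin n) (Fin n) E} (hu : uᴴ = u) :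
    baseNorm C f n u = baseNormSa C f n u := by
  have hC := hB.matrixOrdered
  refine le_antisymm ?_ ?_
  · refine (baseNorm_le_iff hB).mpr ⟨baseNormSa_nonneg _ _, fun r hr => ?_⟩
    obtain ⟨y, hy, z, hz, rfl, h⟩ := exists_of_baseNormSa_lt hB hu hr
    refine ⟨y + z, y + z, ?_, h, h⟩
    have h1 := ((isPos_fin_iff hC).mpr hy).bimul'
      (Matrix.fromRows (1 : Matrix (Fin n) (Fin n) 𝕜) (1 : Matrix (Fin n) (Fin n) 𝕜))
    have h2 := ((isPos_fin_iff hC).mpr hz).bimul'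
      (Matrix.fromRows (1 : Matrix (Fin n) (Fin n) 𝕜) (-1 : Matrix (Fin n) (Fin n) 𝕜))
    rw [Matrix.conjTranspose_fromRows_eq_fromCols_conjTranspose, bimul_fromRows_fromCols] at h1 h2
    have h3 := h1.add hC h2
    rw [hu]
    simpa [Matrix.fromBlocks_add, bimul_neg', neg_bimul, ← sub_eq_add_neg] using h3
  · refine le_of_forall_gt_imp_ge_of_dense fun r hr => ?_
    have hr0 : 0 ≤ r := (baseNormSa_nonneg _ _).trans (le_of_lt hr)
    obtain ⟨p, q, h, hp, hq⟩ := baseBound_of_baseNorm_lt hB hr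
    rw [hu] at h
    -- Compressing `[p, ±u; ±u, q]` by the column `(1, 1)` gives `p + q ± 2u ≥ 0`.
    have hcol : ∀ v : Matrix (Fin n) (Fin n) E, IsPos 𝕜 C (Matrix.fromBlocks p v v q) →
        ((1 / 4 : ℝ) : 𝕜) • (p + v + (v + q)) ∈ C n := by
      intro v hv
      have h1 := hv.bimul'
        (Matrix.fromCols (1 : Matrix (Fin n) (Fin n) 𝕜) (1 : Matrix (Fin n) (Fin n) 𝕜))
      rw [Matrix.conjTranspose_fromCols_eq_fromRows_conjTranspose, bimul_fromCols_fromRows] at h1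
      simp only [Matrix.conjTranspose_one, one_bimul_one] at h1
      exact hC.smul_mem n _ (by norm_num) _ ((isPos_fin_iff hC).mp h1)
    have h4 : ((1 / 4 : ℝ) : 𝕜) + ((1 / 4 : ℝ) : 𝕜) = ((1 / 2 : ℝ) : 𝕜) := by
      rw [← RCLike.ofReal_add]
      norm_num
    have h2 : ((1 / 2 : ℝ) : 𝕜) + ((1 / 2 : ℝ) : 𝕜) = 1 := by
      rw [← RCLike.ofReal_add]
      norm_num
    have key := baseNormSa_sub_le hB (hcol u h) (hcol (-u) h.fromBlocks_neg) hr0 ?_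
    · have : u = ((1 / 4 : ℝ) : 𝕜) • (u + u + (u + u)) := by
        rw [smul_add, smul_add, ← add_smul, h4, ← add_smul, h2, one_smul]
      rwa [← smul_sub, show p + u + (u + q) - (p + -u + (-u + q)) = u + u + (u + u) by abel,
        ← this] at key
    · have h5 := (hp.add hq).smul (RCLike.ofReal_nonneg.mpr (by norm_num : (0 : ℝ) ≤ 1 / 2) :
        (0 : 𝕜) ≤ ((1 / 2 : ℝ) : 𝕜))
      convert h5 using 1
      have h6 : ((1 / 4 : ℝ) : 𝕜) • (p + u + (u + q)) + ((1 / 4 : ℝ) : 𝕜) • (p + -u + (-u + q))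
          = ((1 / 2 : ℝ) : 𝕜) • (p + q) := by
        rw [← h4, ← smul_add, add_smul, ← smul_add]
        congr 1
        abel
      rw [h6]
      ext i j
      simp only [ampl, Matrix.sub_apply, Matrix.smul_apply, Matrix.map_apply, Matrix.add_apply,
        map_smul, map_add, smul_eq_mul]
      linear_combination (-((r : 𝕜) * (1 : Matrix (Fin n) (Fin n) 𝕜) i j)) * h2

theorem eq_zero_of_baseNorm_eq_zero {n : ℕ} {u : Matrix (Fin n) (Fin n) E}
    (h : baseNorm C f n u = 0) : u = 0 := by
  have h0 : tilde u = 0 := by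
    refine hB.separated _ _ (conjTranspose_tilde u) fun ε hε => ?_
    obtain ⟨y, hy, z, hz, hyz, hr⟩ := exists_of_baseNormSa_lt hB (conjTranspose_tilde u)
      (show baseNormSa C f (n + n) (tilde u) < ε / 2 from h.trans_lt (half_pos hε))
    rw [ampl_add] at hr
    refine ⟨y, hy, z, hz, hyz, ?_, ?_⟩
    · refine (norm_le_of_posSemidef_smul_one_sub (ampl_posSemidef hB hy) (half_pos hε).le
        ?_).trans_lt (half_lt_self hε)
      convert hr.add (ampl_posSemidef hB hz) using 1
      abel
    · refine (norm_le_of_posSemidef_smul_one_sub (ampl_posSemidef hB hz) (half_pos hε).le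
        ?_).trans_lt (half_lt_self hε)
      convert hr.add (ampl_posSemidef hB hy) using 1
      abel
  ext i j
  have := congrFun (congrFun h0 (finSumFinEquiv (Sum.inl i))) (finSumFinEquiv (Sum.inr j))
  rwa [tilde, blocks_apply] at this

theorem baseNorm_smul_le {n : ℕ} (c : 𝕜) (u : Matrix (Fin n) (Fin n) E) :
    baseNorm C f n (c • u) ≤ ‖c‖ * baseNorm C f n u := by
  have h1 : ‖(1 : Matrix (Fin n) (Fin n) 𝕜)‖ ≤ 1 :=
    norm_le_of_posSemidef_smul_one_sub Matrix.PosSemidef.one zero_le_one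
      (by simpa using Matrix.PosSemidef.zero)
  have h0 : 0 ≤ baseNorm C f n u := baseNormSa_nonneg _ _
  have h2 := baseNorm_bimul_le hB (c • (1 : Matrix (Fin n) (Fin n) 𝕜)) u 1
  rw [smul_bimul, one_bimul_one, norm_smul] at h2
  refine h2.trans ?_
  calc ‖c‖ * ‖(1 : Matrix (Fin n) (Fin n) 𝕜)‖ * baseNorm C f n u
        * ‖(1 : Matrix (Fin n) (Fin n) 𝕜)‖
      ≤ ‖c‖ * 1 * baseNorm C f n u * 1 := by gcongr
    _ = _ := by ring

/-- The nc base norms satisfy Ruan's axioms. -/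
theorem isOperatorSpace_baseNorm : IsOperatorSpace 𝕜 (baseNorm C f) where
  nonneg n u := baseNormSa_nonneg _ _
  eq_zero n u h := eq_zero_of_baseNorm_eq_zero hB h
  smul n c u := by
    refine le_antisymm (baseNorm_smul_le hB c u) ?_
    rcases eq_or_ne c 0 with rfl | hc
    · rw [norm_zero, zero_mul]
      exact baseNormSa_nonneg _ _
    · have h := baseNorm_smul_le hB c⁻¹ (c • u)
      rwa [smul_smul, inv_mul_cancel₀ hc, one_smul, norm_inv,
        le_inv_mul_iff₀ (norm_pos_iff.mpr hc)] at h
  triangle n u v := by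
    refine le_of_forall_pos_le_add fun ε hε => ?_
    have hu := baseBound_of_baseNorm_lt hB (lt_add_of_pos_right (baseNorm C f n u) (half_pos hε))
    have hv := baseBound_of_baseNorm_lt hB (lt_add_of_pos_right (baseNorm C f n v) (half_pos hε))
    have h0u : 0 ≤ baseNorm C f n u := baseNormSa_nonneg _ _
    have h0v : 0 ≤ baseNorm C f n v := baseNormSa_nonneg _ _
    refine ((hu.add hB.matrixOrdered hv).baseNorm_le hB (by positivity)).trans_eq ?_
    ring
  dsum m n u v := by
    refine le_antisymm ?_ (max_le ?_ ?_)
    · refine (baseNorm_le_iff hB).mpr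
        ⟨le_max_of_le_left (baseNormSa_nonneg _ _), fun s hs => ?_⟩
      obtain ⟨h1, h2⟩ := max_lt_iff.mp hs
      exact (baseBound_of_baseNorm_lt hB h1).blocks hB.matrixOrdered
        (baseBound_of_baseNorm_lt hB h2)
    · refine (baseNorm_le_iff hB).mpr ⟨baseNormSa_nonneg _ _, fun s hs => ?_⟩
      have := (baseBound_of_baseNorm_lt hB hs).submatrix
        (finSumFinEquiv.injective.comp (Sum.inl_injective (α := Fin m) (β := Fin n)))
        (finSumFinEquiv.injective.comp (Sum.inl_injective (α := Fin m) (β := Fin n)))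
      convert this using 1
      ext i j
      exact (blocks_apply u 0 0 v (Sum.inl i) (Sum.inl j)).symm
    · refine (baseNorm_le_iff hB).mpr ⟨baseNormSa_nonneg _ _, fun s hs => ?_⟩
      have := (baseBound_of_baseNorm_lt hB hs).submatrix
        (finSumFinEquiv.injective.comp (Sum.inr_injective (α := Fin m) (β := Fin n)))
        (finSumFinEquiv.injective.comp (Sum.inr_injective (α := Fin m) (β := Fin n)))
      convert this using 1
      ext i j
      exact (blocks_apply u 0 0 v (Sum.inr i) (Sum.inr j)).symm
  bimodule m n a u b := baseNorm_bimul_le hB a u b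

/-- A positive block matrix with vanishing corner has vanishing off-diagonal part: rescaling the
second coordinate makes the nc base norm of that part arbitrarily small. -/
theorem eq_zero_of_isPos_fromBlocks_zero {n : ℕ} {u v q : Matrix (Fin n) (Fin n) E}
    (h : IsPos 𝕜 C (Matrix.fromBlocks 0 u v q)) : u = 0 := by
  have hC := hB.matrixOrdered
  have hv : v = uᴴ := by
    have := h.conjTranspose_eq hC
    rw [Matrix.fromBlocks_conjTranspose, Matrix.fromBlocks_inj] at this
    exact this.2.2.1.symm
  subst hv
  refine eq_zero_of_baseNorm_eq_zero hB (le_antisymm ?_ (baseNormSa_nonneg _ _))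
  refine (baseNorm_le_iff hB).mpr ⟨le_rfl, fun s hs => ?_⟩
  set c : ℝ := ‖q.map f‖ with hc
  have hc0 : 0 ≤ c := norm_nonneg _
  set d : ℝ := c / s + 1 with hd
  have hd1 : 1 ≤ d := le_add_of_nonneg_left (by positivity)
  have hd0 : 0 < d := by positivity
  have hdK : (d : 𝕜) ≠ 0 := by exact_mod_cast hd0.ne'
  -- The second coordinate is scaled by `1 / d`, the first by `d`.
  have h1 := h.fromBlocks_conj ((d : 𝕜) • (1 : Matrix (Fin n) (Fin n) 𝕜))
    ((d : 𝕜)⁻¹ • (1 : Matrix (Fin n) (Fin n) 𝕜))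
  simp only [Matrix.conjTranspose_smul, Matrix.conjTranspose_one, smul_bimul, bimul_smul',
    one_bimul_one, smul_zero, smul_smul, star_inv₀, RCLike.star_def, RCLike.conj_ofReal,
    mul_inv_cancel₀ hdK, inv_mul_cancel₀ hdK, one_smul] at h1
  have hs0 : (0 : 𝕜) ≤ (s : 𝕜) := RCLike.ofReal_nonneg.mpr hs.le
  refine ⟨_, _, h1, ?_, ?_⟩
  · rw [Matrix.map_zero _ (map_zero f), sub_zero]
    exact Matrix.PosSemidef.one.smul hs0
  · refine posSemidef_smul_one_sub (hB.map_posSemidef h1.fromBlocks₂₂).1 ?_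
    have hmap : (((d : 𝕜)⁻¹ * (d : 𝕜)⁻¹) • q).map f = ((d : 𝕜)⁻¹ * (d : 𝕜)⁻¹) • q.map f := by
      ext i j
      simp
    rw [hmap, norm_smul, ← hc, norm_mul, norm_inv, RCLike.norm_ofReal, abs_of_pos hd0, ← mul_inv,
      inv_mul_le_iff₀ (by positivity)]
    have h2 : c ≤ d * s := by
      rw [hd, add_mul, div_mul_cancel₀ _ hs.ne']
      linarith
    nlinarith [mul_le_mul_of_nonneg_right hd1 (mul_nonneg hd0.le hs.le)]

/-- A matrix base ordered space is based on its base. -/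
theorem isBasedOn_base : IsBasedOn 𝕜 C K := by
  intro n u hu
  have hC := hB.matrixOrdered
  obtain ⟨a, b, e, ha, hb, he, hab, hba, hae, heTe, hbT, haa⟩ :=
    exists_sqrt_inverse_kernel (ampl_posSemidef hB hu)
  obtain ⟨-, -, k₀, hk₀, -⟩ := hB.dominated n 0 (by simp)
  rw [hB.base_eq] at hk₀
  have hk₀' : ampl f k₀ = 1 := hk₀.2
  have heue : sandwich e u e = 0 := by
    have h1 := hC.compress n n e u hu
    rw [he] at h1
    refine hB.separated n _ (hC.selfadjoint n _ h1) fun ε hε =>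
      ⟨_, h1, 0, hC.zero_mem n, (sub_zero _).symm, ?_, ?_⟩
    · rwa [ampl_sandwich, heTe, norm_zero]
    · rwa [ampl, Matrix.map_zero _ (map_zero f), norm_zero]
  have hblock := ((isPos_fin_iff hC).mpr hu).bimul'
    (Matrix.fromRows e (1 : Matrix (Fin n) (Fin n) 𝕜))
  rw [Matrix.conjTranspose_fromRows_eq_fromCols_conjTranspose, bimul_fromRows_fromCols, he,
    ← sandwich_eq_bimul e u e, heue, Matrix.conjTranspose_one] at hblock
  have heu := eq_zero_of_isPos_fromBlocks_zero hB hblock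
  have hue : bimul (1 : Matrix (Fin n) (Fin n) 𝕜) u e = 0 := by
    have := congrArg Matrix.conjTranspose heu
    rwa [conjTranspose_bimul, he, hC.selfadjoint n u hu, Matrix.conjTranspose_one,
      Matrix.conjTranspose_zero] at this
  refine ⟨a, ha, sandwich b u b + sandwich e k₀ e, ?_, ?_⟩
  · rw [hB.base_eq]
    refine ⟨hC.add_mem n _ ?_ _ ?_, ?_⟩
    · simpa [hb] using hC.compress n n b u hu
    · simpa [he] using hC.compress n n e k₀ hk₀.1
    · change ampl f _ = 1
      rw [ampl_add, ampl_sandwich, ampl_sandwich, hk₀', Matrix.mul_one, hbT]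
  · have hea : e * a = 0 := by
      have := congrArg Matrix.conjTranspose hae
      rwa [Matrix.conjTranspose_mul, he, ha.1.eq, Matrix.conjTranspose_zero] at this
    rw [ha.1.eq, sandwich_eq_bimul, sandwich_eq_bimul, sandwich_eq_bimul, bimul_add, bimul_bimul,
      bimul_bimul, hae, zero_bimul, add_zero, hab, hba, sub_eq_add_neg, add_bimul, bimul_add',
      bimul_add', neg_bimul, neg_bimul, bimul_neg', bimul_neg', hue, heu, one_bimul_one,
      ← sandwich_eq_bimul e u e, heue]
    simp

theorem baseNorm_le_one_of_mem {n : ℕ} {k : Matrix (Fin n) (Fin n) E} (hk : k ∈ K n) :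
    baseNorm C f n k ≤ 1 := by
  rw [hB.base_eq] at hk
  have hC := hB.matrixOrdered
  rw [baseNorm_eq_baseNormSa hB (hC.selfadjoint n k hk.1)]
  have := baseNormSa_sub_le hB hk.1 (hC.zero_mem n) zero_le_one (by
    have h1 : ampl f k = 1 := hk.2
    rw [add_zero, h1]
    simpa using Matrix.PosSemidef.zero)
  rwa [sub_zero] at this

theorem exists_sandwich_sub_of_baseNorm_lt {n : ℕ} {t : ℝ} {u : Matrix (Fin n) (Fin n) E}
    (hu : uᴴ = u) (h : baseNorm C f n u < t) :
    ∃ c₁ c₂ : Matrix (Fin n) (Fin n) 𝕜, c₁.PosSemidef ∧ c₂.PosSemidef ∧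
      ‖c₁ ^ 2 + c₂ ^ 2‖ ≤ t ∧
      ∃ x₁ ∈ K n, ∃ x₂ ∈ K n, u = sandwich c₁ x₁ c₁ - sandwich c₂ x₂ c₂ := by
  have ht : 0 ≤ t := (baseNormSa_nonneg _ _).trans (le_of_lt h)
  rw [baseNorm_eq_baseNormSa hB hu] at h
  obtain ⟨y, hy, z, hz, rfl, hr⟩ := exists_of_baseNormSa_lt hB hu h
  have hpos := (ampl_posSemidef hB hy).add (ampl_posSemidef hB hz)
  obtain ⟨c₁, hc₁, x₁, hx₁, rfl⟩ := isBasedOn_base hB n y hy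
  obtain ⟨c₂, hc₂, x₂, hx₂, rfl⟩ := isBasedOn_base hB n z hz
  have hf : ∀ c : Matrix (Fin n) (Fin n) 𝕜, c.PosSemidef → ∀ x ∈ K n,
      ampl f (sandwich cᴴ x c) = c ^ 2 := by
    intro c hc x hx
    rw [hB.base_eq] at hx
    have h1 : ampl f x = 1 := hx.2
    rw [ampl_sandwich, h1, Matrix.mul_one, hc.1.eq, pow_two]
  rw [ampl_add, hf c₁ hc₁ x₁ hx₁, hf c₂ hc₂ x₂ hx₂] at hr
  rw [hf c₁ hc₁ x₁ hx₁, hf c₂ hc₂ x₂ hx₂] at hpos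
  refine ⟨c₁, c₂, hc₁, hc₂, norm_le_of_posSemidef_smul_one_sub hpos ht hr, x₁, hx₁, x₂, hx₂, ?_⟩
  rw [hc₁.1.eq, hc₂.1.eq]

end MatrixBaseOrdered

/-! ### Pairings with matrices of functionals -/

section Pairing

set_option linter.unusedSectionVars false

open scoped Kronecker

variable {𝕜 : Type*} [RCLike 𝕜] {E : Type*} [AddCommGroup E] [Module 𝕜 E]
  {ι ι' κ κ' μ μ' ν ν' : Type*} [Fintype κ] [Fintype κ'] [Fintype μ] [Fintype μ']
  [DecidableEq κ] [DecidableEq κ'] [DecidableEq μ] [DecidableEq μ'] [DecidableEq ι]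
  [DecidableEq ι']

/-- The amplification of a matrix of functionals at a matrix over `E`, for arbitrary index types
and shapes; `pairing` is the case of square matrices over `Fin n`. -/
def pairingGen (ψ : Matrix ν ν' (E →ₗ[𝕜] 𝕜)) (x : Matrix ι ι' E) : Matrix (ι × ν) (ι' × ν') 𝕜 :=
  Matrix.of fun p q => ψ p.2 q.2 (x p.1 q.1)

theorem pairing_eq_pairingGen {m n : ℕ} (ψ : Matrix (Fin n) (Fin n) (E →ₗ[𝕜] 𝕜))
    (x : Matrix (Fin m) (Fin m) E) : pairing ψ x = pairingGen ψ x := rfl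

theorem sub_kronecker (A B : Matrix ι κ 𝕜) (D : Matrix μ ν 𝕜) :
    (A - B) ⊗ₖ D = A ⊗ₖ D - B ⊗ₖ D := by
  ext p q
  simp [sub_mul]

theorem kronecker_one_mul_mul_apply (a : Matrix ι κ 𝕜) (M : Matrix (κ × μ) (κ' × μ') 𝕜)
    (b : Matrix κ' ι' 𝕜) (p : ι × μ) (q : ι' × μ') :
    ((a ⊗ₖ (1 : Matrix μ μ 𝕜)) * M * (b ⊗ₖ (1 : Matrix μ' μ' 𝕜))) p q
      = ∑ k, ∑ l, a p.1 k * b l q.1 * M (k, p.2) (l, q.2) := by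
  simp only [Matrix.mul_apply, Fintype.sum_prod_type, Matrix.kroneckerMap_apply,
    Matrix.one_apply, mul_ite, mul_one, mul_zero, ite_mul, zero_mul, Finset.sum_ite_eq,
    Finset.sum_ite_eq', Finset.mem_univ, if_true, Finset.sum_mul]
  rw [Finset.sum_comm]
  refine Finset.sum_congr rfl fun k _ => Finset.sum_congr rfl fun l _ => ?_
  ring

theorem one_kronecker_mul_mul_apply (a : Matrix ι κ 𝕜) (M : Matrix (μ × κ) (μ' × κ') 𝕜)
    (b : Matrix κ' ι' 𝕜) (p : μ × ι) (q : μ' × ι') :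
    (((1 : Matrix μ μ 𝕜) ⊗ₖ a) * M * ((1 : Matrix μ' μ' 𝕜) ⊗ₖ b)) p q
      = ∑ k, ∑ l, a p.2 k * b l q.2 * M (p.1, k) (q.1, l) := by
  simp only [Matrix.mul_apply, Fintype.sum_prod_type_right, Matrix.kroneckerMap_apply,
    Matrix.one_apply, mul_ite, mul_zero, ite_mul, zero_mul, one_mul, Finset.sum_ite_eq,
    Finset.sum_ite_eq', Finset.mem_univ, if_true, Finset.sum_mul]
  rw [Finset.sum_comm]
  refine Finset.sum_congr rfl fun k _ => Finset.sum_congr rfl fun l _ => ?_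
  ring

theorem pairingGen_bimul (ψ : Matrix μ μ' (E →ₗ[𝕜] 𝕜)) (a : Matrix ι κ 𝕜) (x : Matrix κ κ' E)
    (b : Matrix κ' ι' 𝕜) :
    pairingGen ψ (bimul a x b)
      = (a ⊗ₖ (1 : Matrix μ μ 𝕜)) * pairingGen ψ x * (b ⊗ₖ (1 : Matrix μ' μ' 𝕜)) := by
  ext p q
  rw [kronecker_one_mul_mul_apply]
  simp [pairingGen, bimul_apply]

theorem pairingGen_bimul_left (a : Matrix ι κ 𝕜) (ψ : Matrix κ κ' (E →ₗ[𝕜] 𝕜))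
    (b : Matrix κ' ι' 𝕜) (x : Matrix μ μ' E) :
    pairingGen (bimul a ψ b) x
      = ((1 : Matrix μ μ 𝕜) ⊗ₖ a) * pairingGen ψ x * ((1 : Matrix μ' μ' 𝕜) ⊗ₖ b) := by
  ext p q
  rw [one_kronecker_mul_mul_apply]
  simp [pairingGen, bimul_apply]

/-- A functional that is bounded by `c` for Ruan matrix norms `N` is completely bounded by `c`. -/
theorem norm_map_le_of_bounded [StarAddMonoid E] [StarModule 𝕜 E]
    {N : ∀ n : ℕ, Matrix (Fin n) (Fin n) E → ℝ} (hN : IsOperatorSpace 𝕜 N)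
    {φ : E →ₗ[𝕜] 𝕜} {c : ℝ} (hc : 0 ≤ c) (h : ∀ x, ‖φ x‖ ≤ c * N 1 (single x)) {m : ℕ}
    (x : Matrix (Fin m) (Fin m) E) : ‖x.map φ‖ ≤ c * N m x := by
  rw [Matrix.l2_opNorm_def]
  refine ContinuousLinearMap.opNorm_le_bound _ (mul_nonneg hc (hN.nonneg m x)) fun v => ?_
  set w : Fin m → 𝕜 := x.map φ *ᵥ v.ofLp with hw
  change ‖WithLp.toLp 2 w‖ ≤ _
  have hcol : ∀ v : Fin m → 𝕜, ‖Matrix.replicateCol (Fin 1) v‖ ≤ ‖WithLp.toLp 2 v‖ := by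
    intro v
    refine norm_le_of_posSemidef_sub_conjTranspose_mul_self (norm_nonneg _) ?_
    convert Matrix.PosSemidef.zero using 1
    ext i l
    rw [Matrix.sub_apply, Matrix.smul_apply, ← star_dotProduct_self_eq_norm_sq,
      Subsingleton.elim i l, Matrix.one_apply_eq, smul_eq_mul, mul_one, Matrix.zero_apply,
      sub_eq_zero]
    rfl
  have h1 := hN.bimodule 1 m (Matrix.replicateCol (Fin 1) w)ᴴ x (Matrix.replicateCol (Fin 1) v.ofLp)
  set y : Matrix (Fin 1) (Fin 1) E := sandwich (Matrix.replicateCol (Fin 1) w)ᴴ x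
    (Matrix.replicateCol (Fin 1) v.ofLp) with hy
  have hys : single (y 0 0) = y := by
    ext i l
    rw [Subsingleton.elim i 0, Subsingleton.elim l 0]
    rfl
  have h2 : φ (y 0 0) = ((‖WithLp.toLp 2 w‖ ^ 2 : ℝ) : 𝕜) := by
    have h3 := congrFun (congrFun (map_bimul φ (Matrix.replicateCol (Fin 1) w)ᴴ x
      (Matrix.replicateCol (Fin 1) v.ofLp)) 0) 0
    rw [← star_dotProduct_self_eq_norm_sq]
    rw [Matrix.mul_assoc] at h3
    exact h3
  have h4 := h (y 0 0)
  rw [hys, h2, RCLike.norm_ofReal, abs_of_nonneg (by positivity)] at h4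
  rw [Matrix.l2_opNorm_conjTranspose] at h1
  have hx0 := hN.nonneg m x
  have h5 : ‖WithLp.toLp 2 w‖ ^ 2 ≤ c * (‖WithLp.toLp 2 w‖ * N m x * ‖v‖) := by
    refine h4.trans (mul_le_mul_of_nonneg_left (h1.trans ?_) hc)
    gcongr
    · exact hcol w
    · exact hcol v.ofLp
  rcases (norm_nonneg (WithLp.toLp 2 w)).eq_or_lt with h0 | h0
  · rw [← h0]
    positivity
  · nlinarith

end Pairing

/-! ### The matrix ordered dual -/

section Dual

open scoped Kronecker

set_option linter.unusedSectionVars false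

variable {𝕜 : Type*} [RCLike 𝕜] {E : Type*} [AddCommGroup E] [Module 𝕜 E]
  [StarAddMonoid E] [StarModule 𝕜 E]
  {C K : ∀ n : ℕ, Set (Matrix (Fin n) (Fin n) E)} {f : E →ₗ[𝕜] 𝕜}
  {F : Type*} [AddCommGroup F] [Module 𝕜 F] [StarAddMonoid F] [StarModule 𝕜 F]
  {j : F →ₗ[𝕜] (E →ₗ[𝕜] 𝕜)}

theorem pairingGen_unitDiag {e : F} (he : j e = f) (t : ℝ) {n : ℕ} {ι : Type*}
    (x : Matrix ι ι E) :
    pairingGen ((unitDiag 𝕜 e t n).map j) x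
      = (t : 𝕜) • (x.map f ⊗ₖ (1 : Matrix (Fin n) (Fin n) 𝕜)) := by
  ext p q
  by_cases h : p.2 = q.2
  · simp [pairingGen, unitDiag, h, he, RCLike.real_smul_eq_coe_mul, Matrix.one_apply]
  · simp [pairingGen, unitDiag, h, Matrix.one_apply_ne h]

theorem IsPos.pairingGen_posSemidef {n : ℕ} {ψ : Matrix (Fin n) (Fin n) F}
    (hψ : ψ ∈ dualCone C j n) {ι : Type*} [Fintype ι] {x : Matrix ι ι E} (hx : IsPos 𝕜 C x)
    (hC : IsMatrixOrdered 𝕜 C) : (pairingGen (ψ.map j) x).PosSemidef := by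
  classical
  let e := (Fintype.equivFin ι).symm
  have h := hψ _ _ ((isPos_fin_iff hC).mp (hx.submatrix e))
  have h2 := h.submatrix (Prod.map e.symm id : ι × Fin n → _)
  convert h2 using 1
  ext p q
  simp [pairingGen, pairing]

variable (hB : IsMatrixBaseOrdered C K f)
include hB

theorem exists_isPos_single (x : E) :
    ∃ p q, IsPos 𝕜 C (Matrix.fromBlocks p (single x) (single x)ᴴ q) := by
  obtain ⟨p, q, h, -⟩ := baseBound_of_baseNorm_lt hB (lt_add_one (baseNorm C f 1 (single x)))
  exact ⟨p, q, h⟩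

/-- By `isBasedOn_base`, complete positivity need only be tested on the base. -/
theorem mem_dualCone_of_base {n : ℕ} {ψ : Matrix (Fin n) (Fin n) F}
    (h : ∀ m, ∀ k ∈ K m, (pairingGen (ψ.map j) k).PosSemidef) : ψ ∈ dualCone C j n := by
  intro m x hx
  obtain ⟨a, -, k, hk, rfl⟩ := isBasedOn_base hB m x hx
  rw [pairing_eq_pairingGen, sandwich_eq_bimul, pairingGen_bimul]
  convert (h m k hk).conjTranspose_mul_mul_same (a ⊗ₖ (1 : Matrix (Fin n) (Fin n) 𝕜)) using 3
  rw [Matrix.conjTranspose_kronecker, Matrix.conjTranspose_one]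

variable (hj : Function.Injective j) (hstar : ∀ φ x, j (star φ) x = star (j φ (star x)))

include hj hstar in
theorem isMatrixOrdered_dualCone : IsMatrixOrdered 𝕜 (dualCone C j) where
  selfadjoint n ψ hψ := by
    ext i l
    refine hj (LinearMap.ext fun x => ?_)
    obtain ⟨p, q, h⟩ := exists_isPos_single hB (star x)
    have h1 := (h.pairingGen_posSemidef hψ hB.matrixOrdered).1
    have h2 := congrFun (congrFun h1 (Sum.inr 0, i)) (Sum.inl 0, l)
    simpa [pairingGen, single, hstar] using h2
  zero_mem n m x _ := by
    have : pairing ((0 : Matrix (Fin n) (Fin n) F).map j) x = 0 := by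
      ext p q
      simp [pairing]
    rw [this]
    exact Matrix.PosSemidef.zero
  add_mem n ψ hψ χ hχ m x hx := by
    convert (hψ m x hx).add (hχ m x hx) using 1
    ext p q
    simp [pairing]
  smul_mem n t ht ψ hψ m x hx := by
    convert (hψ m x hx).smul (RCLike.ofReal_nonneg.mpr ht : (0 : 𝕜) ≤ (t : 𝕜)) using 1
    ext p q
    simp [pairing, RCLike.real_smul_eq_coe_mul]
  proper n ψ hψ hψ' := by
    ext i l
    refine hj (LinearMap.ext fun x => ?_)
    obtain ⟨p, q, h⟩ := exists_isPos_single hB x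
    have h1 := h.pairingGen_posSemidef hψ hB.matrixOrdered
    have h2 := h.pairingGen_posSemidef hψ' hB.matrixOrdered
    have h3 := norm_le_of_posSemidef_smul_one_sub h1 le_rfl (by
      convert h2 using 1
      ext p q
      simp [pairingGen])
    have h5 : pairingGen (ψ.map j) (Matrix.fromBlocks p (single x) (single x)ᴴ q) = 0 :=
      norm_le_zero_iff.mp h3
    have h4 := congrFun (congrFun h5 (Sum.inl 0, i)) (Sum.inr 0, l)
    simpa [pairingGen, single] using h4
  compress n m a ψ hψ l x hx := by
    have h1 : (sandwich aᴴ ψ a).map j = bimul aᴴ (ψ.map j) a := by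
      ext i k : 2
      simp [sandwich, bimul_apply]
    rw [h1, pairing_eq_pairingGen, pairingGen_bimul_left]
    convert (hψ l x hx).conjTranspose_mul_mul_same ((1 : Matrix (Fin l) (Fin l) 𝕜) ⊗ₖ a) using 3
    · rw [Matrix.conjTranspose_kronecker, Matrix.conjTranspose_one]
    · rfl

/-- Every matrix of bounded functionals is completely bounded for the nc base norms. -/
theorem exists_norm_pairing_le (hbdd : ∀ φ, ∃ c : ℝ, ∀ x, ‖j φ x‖ ≤ c * baseNorm C f 1 (single x))
    {n : ℕ} (ψ : Matrix (Fin n) (Fin n) F) :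
    ∃ c : ℝ, 0 ≤ c ∧ ∀ (m : ℕ) (x : Matrix (Fin m) (Fin m) E),
      ‖pairingGen (ψ.map j) x‖ ≤ c * baseNorm C f m x := by
  have hbdd' : ∀ φ, ∃ c : ℝ, 0 ≤ c ∧ ∀ x, ‖j φ x‖ ≤ c * baseNorm C f 1 (single x) := by
    intro φ
    obtain ⟨c, hc⟩ := hbdd φ
    refine ⟨max c 0, le_max_right _ _, fun x => (hc x).trans ?_⟩
    exact mul_le_mul_of_nonneg_right (le_max_left _ _) (baseNormSa_nonneg _ _)
  choose c hc0 hc using hbdd'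
  refine ⟨∑ i, ∑ l, c (ψ i l), Finset.sum_nonneg fun i _ => Finset.sum_nonneg fun l _ => hc0 _,
    fun m x => ?_⟩
  -- The pairing is the sum of the scalar amplifications, placed at the matrix units.
  let R (i : Fin n) : Matrix (Fin m) (Fin m × Fin n) 𝕜 := selectMatrix 𝕜 fun k => (k, i)
  have hR : ∀ i, ‖R i‖ ≤ 1 := by
    intro i
    have h1 : R i * (R i)ᴴ = 1 := selectMatrix_mul_conjTranspose fun a b h => congrArg Prod.fst h
    rw [← Matrix.l2_opNorm_conjTranspose]
    refine norm_le_of_posSemidef_sub_conjTranspose_mul_self zero_le_one ?_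
    rw [Matrix.conjTranspose_conjTranspose, h1]
    simpa using Matrix.PosSemidef.zero
  have hsum : pairingGen (ψ.map j) x = ∑ i, ∑ l, (R i)ᴴ * x.map (j (ψ i l)) * R l := by
    ext p q
    obtain ⟨a, b⟩ := p
    obtain ⟨a', b'⟩ := q
    simp [Matrix.sum_apply, Matrix.mul_apply, R, selectMatrix, pairingGen, ite_and, apply_ite]
  rw [hsum, Finset.sum_mul]
  refine (norm_sum_le _ _).trans (Finset.sum_le_sum fun i _ => ?_)
  rw [Finset.sum_mul]
  refine (norm_sum_le _ _).trans (Finset.sum_le_sum fun l _ => ?_)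
  have h1 := norm_map_le_of_bounded (isOperatorSpace_baseNorm hB) (hc0 (ψ i l)) (hc (ψ i l)) x
  calc ‖(R i)ᴴ * x.map (j (ψ i l)) * R l‖ ≤ ‖(R i)ᴴ‖ * ‖x.map (j (ψ i l))‖ * ‖R l‖ :=
        (Matrix.l2_opNorm_mul _ _).trans (by gcongr; exact Matrix.l2_opNorm_mul _ _)
    _ ≤ 1 * ‖x.map (j (ψ i l))‖ * 1 := by
        gcongr
        · rw [Matrix.l2_opNorm_conjTranspose]
          exact hR i
        · exact hR l
    _ ≤ _ := by simpa using h1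

include hj hstar in
/-- The base function is an archimedean matrix order unit of the dual. -/
theorem isOperatorSystem_dualCone {e : F} (he : j e = f)
    (hbdd : ∀ φ, ∃ c : ℝ, ∀ x, ‖j φ x‖ ≤ c * baseNorm C f 1 (single x)) :
    IsOperatorSystem 𝕜 (dualCone C j) e where
  matrixOrdered := isMatrixOrdered_dualCone hB hj hstar
  selfadjoint := hj (LinearMap.ext fun x => by
    rw [hstar, he, hB.selfadjoint, star_star])
  orderUnit n ψ hψ := by
    obtain ⟨c, hc0, hc⟩ := exists_norm_pairing_le hB hbdd ψ
    refine ⟨c + 1, by positivity, mem_dualCone_of_base hB fun m k hk => ?_⟩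
    have hk1 := baseNorm_le_one_of_mem hB hk
    rw [hB.base_eq] at hk
    have hkf : k.map f = 1 := hk.2
    have hks := hB.matrixOrdered.selfadjoint m k hk.1
    have hherm : (pairingGen (ψ.map j) k).IsHermitian := by
      ext p q
      have h1 := congrFun (congrFun hψ p.2) q.2
      have h2 := congrFun (congrFun hks q.1) p.1
      simp only [Matrix.conjTranspose_apply] at h1 h2
      simp only [pairingGen, Matrix.conjTranspose_apply, Matrix.of_apply, Matrix.map_apply]
      rw [← h1, hstar, ← h2]
    have h3 := posSemidef_smul_one_sub hherm (r := c + 1)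
      ((hc m k).trans ((mul_le_mul_of_nonneg_left hk1 hc0).trans (by linarith)))
    convert h3 using 1
    have h4 : pairingGen ((unitDiag 𝕜 e (c + 1) n - ψ).map j) k
        = pairingGen ((unitDiag 𝕜 e (c + 1) n).map j) k - pairingGen (ψ.map j) k := by
      ext p q
      simp [pairingGen]
    rw [h4, pairingGen_unitDiag he, hkf, Matrix.one_kronecker_one]
  archimedean n ψ hψ m x hx := by
    have hN : (x.map f ⊗ₖ (1 : Matrix (Fin n) (Fin n) 𝕜)).PosSemidef :=
      (ampl_posSemidef hB hx).kronecker Matrix.PosSemidef.one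
    have hadd : ∀ t : ℝ, 0 < t →
        ((t : 𝕜) • (x.map f ⊗ₖ (1 : Matrix (Fin n) (Fin n) 𝕜)) + pairing (ψ.map j) x).PosSemidef := by
      intro t ht
      convert hψ t ht m x hx using 1
      rw [← pairingGen_unitDiag he]
      ext p q
      simp [pairingGen, pairing]
    have hherm : (pairing (ψ.map j) x).IsHermitian := by
      have h1 := (hadd 1 one_pos).1.sub hN.1
      simpa using h1
    refine Matrix.PosSemidef.of_dotProduct_mulVec_nonneg hherm fun v => ?_
    rw [RCLike.nonneg_iff]
    refine ⟨?_, hherm.im_star_dotProduct_mulVec_self v⟩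
    set d : ℝ := RCLike.re (star v ⬝ᵥ ((x.map f ⊗ₖ (1 : Matrix (Fin n) (Fin n) 𝕜)) *ᵥ v)) with hd
    have hd0 : 0 ≤ d := hN.re_dotProduct_nonneg v
    refine le_of_forall_pos_le_add fun ε hε => ?_
    have h1 := (hadd (ε / (d + 1)) (by positivity)).re_dotProduct_nonneg v
    rw [Matrix.add_mulVec, dotProduct_add, Matrix.smul_mulVec, dotProduct_smul, map_add,
      smul_eq_mul, RCLike.re_ofReal_mul, ← hd] at h1
    have h2 : ε / (d + 1) * d ≤ ε := by
      rw [div_mul_eq_mul_div, div_le_iff₀ (by positivity)]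
      nlinarith
    linarith

include hstar in
/-- A number `t > 0` is admissible for the order unit norm of `ψ` exactly if it bounds the
completely bounded norm of `ψ` for the nc base norms. -/
theorem blocks_mem_dualCone_iff {e : F} (he : j e = f) {n : ℕ} (ψ : Matrix (Fin n) (Fin n) F)
    {t : ℝ} (ht : 0 < t) :
    blocks (unitDiag 𝕜 e t n) ψ ψᴴ (unitDiag 𝕜 e t n) ∈ dualCone C j (n + n) ↔
      ∀ (m : ℕ) (x : Matrix (Fin m) (Fin m) E), baseNorm C f m x ≤ 1 →
        ‖pairingGen (ψ.map j) x‖ ≤ t := by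
  have ht0 : (0 : 𝕜) ≤ (t : 𝕜) := RCLike.ofReal_nonneg.mpr ht.le
  have hstar' : ∀ (m : ℕ) (x : Matrix (Fin m) (Fin m) E),
      pairingGen (ψᴴ.map j) xᴴ = (pairingGen (ψ.map j) x)ᴴ := by
    intro m x
    ext p q
    simp [pairingGen, hstar]
  constructor
  · intro h m x hx
    refine le_of_forall_gt_imp_ge_of_dense fun r hr => ?_
    have hs : 1 < r / t := (one_lt_div ht).mpr hr
    obtain ⟨p, q, hX, hp, hq⟩ := baseBound_of_baseNorm_lt hB (hx.trans_lt hs)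
    have h1 := hX.pairingGen_posSemidef h hB.matrixOrdered
    have h2 := h1.submatrix (Sum.elim
      (fun a => (Sum.inl a.1, finSumFinEquiv (Sum.inl a.2)))
      (fun a => (Sum.inr a.1, finSumFinEquiv (Sum.inr a.2))) :
        (Fin m × Fin n) ⊕ (Fin m × Fin n) → (Fin m ⊕ Fin m) × Fin (n + n))
    have h3 : ∀ {p : Matrix (Fin m) (Fin m) E},
        (((r / t : ℝ) : 𝕜) • (1 : Matrix (Fin m) (Fin m) 𝕜) - p.map f).PosSemidef →
        ((r : 𝕜) • (1 : Matrix (Fin m × Fin n) (Fin m × Fin n) 𝕜)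
          - (t : 𝕜) • (p.map f ⊗ₖ (1 : Matrix (Fin n) (Fin n) 𝕜))).PosSemidef := by
      intro p hp
      convert (hp.kronecker (Matrix.PosSemidef.one (n := Fin n) (R := 𝕜))).smul ht0 using 1
      rw [sub_kronecker, Matrix.smul_kronecker, Matrix.one_kronecker_one, smul_sub,
        smul_smul, ← RCLike.ofReal_mul, mul_div_cancel₀ _ ht.ne']
    have h4 := h2.add (posSemidef_fromBlocks_diagonal (h3 hp) (h3 hq))
    refine (posSemidef_fromBlocks_iff_norm_le _ (ht.trans hr)).mp ?_
    convert h4 using 1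
    rw [← hstar', ← pairingGen_unitDiag he, ← pairingGen_unitDiag he]
    ext a b
    rcases a with a | a <;> rcases b with b | b <;>
      simp [pairingGen, Matrix.map_apply, blocks_apply, -finSumFinEquiv_apply_left,
        -finSumFinEquiv_apply_right]
  · intro h
    refine mem_dualCone_of_base hB fun m k hk => ?_
    have hk1 := baseNorm_le_one_of_mem hB hk
    rw [hB.base_eq] at hk
    have hkf : k.map f = 1 := hk.2
    have hks := hB.matrixOrdered.selfadjoint m k hk.1
    have h1 := (posSemidef_fromBlocks_iff_norm_le _ ht).mpr (h m k hk1)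
    have h2 := h1.submatrix (fun a => (finSumFinEquiv.symm a.2).map (Prod.mk a.1) (Prod.mk a.1) :
      Fin m × Fin (n + n) → (Fin m × Fin n) ⊕ (Fin m × Fin n))
    convert h2 using 1
    rw [← hstar', hks, ← Matrix.one_kronecker_one, ← hkf, ← pairingGen_unitDiag he]
    ext ⟨a, a'⟩ ⟨b, b'⟩
    obtain ⟨a', rfl⟩ := finSumFinEquiv.surjective a'
    obtain ⟨b', rfl⟩ := finSumFinEquiv.surjective b'
    rcases a' with a' | a' <;> rcases b' with b' | b' <;>
      simp [pairingGen, Matrix.map_apply, blocks_apply, -finSumFinEquiv_apply_left,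
        -finSumFinEquiv_apply_right]

include hj hstar in
/-- With the order unit norms of the base function, the dual is the operator space dual for the
nc base norms. -/
theorem isOperatorSpaceDual_dualCone {e : F} (he : j e = f)
    (hrange : ∀ φ : E →ₗ[𝕜] 𝕜,
      (∃ ψ, j ψ = φ) ↔ ∃ c : ℝ, ∀ x, ‖φ x‖ ≤ c * baseNorm C f 1 (single x)) :
    IsOperatorSpaceDual (baseNorm C f) (orderUnitNorm 𝕜 (dualCone C j) e) j where
  injective := hj
  range_eq := hrange
  norm_eq n ψ := by
    have hiff := fun t (ht : 0 < t) => blocks_mem_dualCone_iff hB hstar he ψ ht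
    obtain ⟨c, hc0, hc⟩ := exists_norm_pairing_le hB (fun φ => (hrange (j φ)).mp ⟨φ, rfl⟩) ψ
    have hbelow : BddBelow {t : ℝ | 0 < t ∧
        blocks (unitDiag 𝕜 e t n) ψ ψᴴ (unitDiag 𝕜 e t n) ∈ dualCone C j (n + n)} :=
      ⟨0, fun t ht => ht.1.le⟩
    constructor
    · rintro _ ⟨m, x, hx, rfl⟩
      refine le_csInf ⟨c + 1, by positivity, (hiff _ (by positivity)).mpr fun m x hx => ?_⟩
        fun t ht => (hiff t ht.1).mp ht.2 m x hx
      exact (hc m x).trans ((mul_le_mul_of_nonneg_left hx hc0).trans (by linarith))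
    · intro b hb
      have hb' : ∀ (m : ℕ) (x : Matrix (Fin m) (Fin m) E), baseNorm C f m x ≤ 1 →
          ‖pairingGen (ψ.map j) x‖ ≤ b := fun m x hx => hb ⟨m, x, hx, rfl⟩
      have hb0 : 0 ≤ b := (norm_nonneg _).trans
        (hb' 0 0 ((baseNorm_zero hB 0).le.trans zero_le_one))
      refine le_of_forall_pos_le_add fun ε hε => csInf_le hbelow ⟨by positivity, ?_⟩
      exact (hiff _ (by positivity)).mpr fun m x hx => (hb' m x hx).trans (by linarith)

end Dual

/-! ### The sesquilinear forms of matrices over the Paulsen system -/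

section PaulsenForm

set_option linter.unusedSectionVars false

variable {𝕜 : Type*} [RCLike 𝕜]
  {H : Type*} [NormedAddCommGroup H] [InnerProductSpace 𝕜 H] [CompleteSpace H]
  {K : Type*} [NormedAddCommGroup K] [InnerProductSpace 𝕜 K] [CompleteSpace K]
  {V : Submodule 𝕜 (K →L[𝕜] H)}
  {ι ι' κ κ' : Type*} [Fintype ι] [Fintype ι'] [Fintype κ] [Fintype κ']

/-- The sesquilinear form `(v, w) ↦ ⟨v, x w⟩` of a matrix `x` over the Paulsen system, on families
of vectors of `H ⊕ K`. -/
def opForm (x : Matrix ι κ (paulsen V)) (v : ι → WithLp 2 (H × K)) (w : κ → WithLp 2 (H × K)) : 𝕜 :=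
  ∑ i, ∑ j, ⟪v i, (x i j).1 (w j)⟫_𝕜

theorem opForm_add (x y : Matrix ι κ (paulsen V)) (v : ι → WithLp 2 (H × K))
    (w : κ → WithLp 2 (H × K)) : opForm (x + y) v w = opForm x v w + opForm y v w := by
  simp [opForm, inner_add_right, Finset.sum_add_distrib]

theorem opForm_neg (x : Matrix ι κ (paulsen V)) (v : ι → WithLp 2 (H × K))
    (w : κ → WithLp 2 (H × K)) : opForm (-x) v w = -opForm x v w := by
  simp [opForm, -WithLp.prod_inner_apply]

theorem opForm_sub (x y : Matrix ι κ (paulsen V)) (v : ι → WithLp 2 (H × K))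
    (w : κ → WithLp 2 (H × K)) : opForm (x - y) v w = opForm x v w - opForm y v w := by
  rw [sub_eq_add_neg, opForm_add, opForm_neg, sub_eq_add_neg]

theorem opForm_smul (c : 𝕜) (x : Matrix ι κ (paulsen V)) (v : ι → WithLp 2 (H × K))
    (w : κ → WithLp 2 (H × K)) : opForm (c • x) v w = c * opForm x v w := by
  simp [opForm, inner_smul_right, Finset.mul_sum]

theorem opForm_add_left (x : Matrix ι κ (paulsen V)) (v v' : ι → WithLp 2 (H × K))
    (w : κ → WithLp 2 (H × K)) : opForm x (v + v') w = opForm x v w + opForm x v' w := by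
  simp [opForm, inner_add_left, Finset.sum_add_distrib]

theorem opForm_add_right (x : Matrix ι κ (paulsen V)) (v : ι → WithLp 2 (H × K))
    (w w' : κ → WithLp 2 (H × K)) : opForm x v (w + w') = opForm x v w + opForm x v w' := by
  simp [opForm, inner_add_right, Finset.sum_add_distrib]

theorem opForm_neg_left (x : Matrix ι κ (paulsen V)) (v : ι → WithLp 2 (H × K))
    (w : κ → WithLp 2 (H × K)) : opForm x (-v) w = -opForm x v w := by
  simp [opForm, -WithLp.prod_inner_apply]

theorem opForm_neg_right (x : Matrix ι κ (paulsen V)) (v : ι → WithLp 2 (H × K))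
    (w : κ → WithLp 2 (H × K)) : opForm x v (-w) = -opForm x v w := by
  simp [opForm, -WithLp.prod_inner_apply]

theorem opForm_bimul (a : Matrix ι ι' 𝕜) (x : Matrix ι' κ' (paulsen V)) (b : Matrix κ' κ 𝕜)
    (v : ι → WithLp 2 (H × K)) (w : κ → WithLp 2 (H × K)) :
    opForm (bimul a x b) v w
      = opForm x (fun k => ∑ i, star (a i k) • v i) (fun l => ∑ j, b l j • w j) := by
  simp only [opForm, bimul_apply, Submodule.coe_sum, Submodule.coe_smul, sum_inner,
    sum_apply, smul_apply, inner_sum, map_sum, map_smul,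
    inner_smul_left, inner_smul_right, RCLike.star_def, RCLike.conj_conj]
  simp only [Finset.mul_sum]
  rw [Finset.sum_congr rfl fun i _ => Finset.sum_comm, Finset.sum_comm]
  refine Finset.sum_congr rfl fun k _ => ?_
  rw [Finset.sum_congr rfl fun i _ => Finset.sum_comm, Finset.sum_comm]
  refine Finset.sum_congr rfl fun l _ => ?_
  rw [Finset.sum_comm]
  refine Finset.sum_congr rfl fun j _ => Finset.sum_congr rfl fun i _ => ?_
  ring

theorem opForm_conjTranspose (x : Matrix ι κ (paulsen V)) (v : κ → WithLp 2 (H × K))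
    (w : ι → WithLp 2 (H × K)) : opForm xᴴ v w = star (opForm x w v) := by
  simp only [opForm, star_sum, Matrix.conjTranspose_apply, coe_star_paulsen,
    ContinuousLinearMap.adjoint_inner_right, RCLike.star_def, inner_conj_symm]
  exact Finset.sum_comm

theorem opForm_fromBlocks (p : Matrix ι ι' (paulsen V)) (u : Matrix ι κ' (paulsen V))
    (u' : Matrix κ ι' (paulsen V)) (q : Matrix κ κ' (paulsen V)) (v : ι ⊕ κ → WithLp 2 (H × K))
    (w : ι' ⊕ κ' → WithLp 2 (H × K)) :
    opForm (Matrix.fromBlocks p u u' q) v w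
      = opForm p (v ∘ Sum.inl) (w ∘ Sum.inl) + opForm u (v ∘ Sum.inl) (w ∘ Sum.inr)
        + (opForm u' (v ∘ Sum.inr) (w ∘ Sum.inl) + opForm q (v ∘ Sum.inr) (w ∘ Sum.inr)) := by
  simp only [opForm, Fintype.sum_sum_type, Finset.sum_add_distrib, Matrix.fromBlocks_apply₁₁,
    Matrix.fromBlocks_apply₁₂, Matrix.fromBlocks_apply₂₁, Matrix.fromBlocks_apply₂₂,
    Function.comp_apply]
  abel

theorem opForm_single [DecidableEq ι] [DecidableEq κ] (x : Matrix ι κ (paulsen V)) (i : ι) (j : κ)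
    (a b : WithLp 2 (H × K)) : opForm x (Pi.single i a) (Pi.single j b) = ⟪a, (x i j).1 b⟫_𝕜 := by
  rw [opForm, Finset.sum_eq_single i, Finset.sum_eq_single j]
  · rw [Pi.single_eq_same, Pi.single_eq_same]
  · intro l _ hl
    rw [Pi.single_eq_of_ne hl, map_zero, inner_zero_right]
  · simp
  · intro l _ hl
    simp [Pi.single_eq_of_ne hl, -WithLp.prod_inner_apply]
  · simp

theorem inner_matOp {n : ℕ} (x : Matrix (Fin n) (Fin n) (paulsen V))
    (v w : PiLp 2 (fun _ : Fin n => WithLp 2 (H × K))) :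
    ⟪v, matOp (x.map fun T => (T : WithLp 2 (H × K) →L[𝕜] WithLp 2 (H × K))) w⟫_𝕜
      = opForm x v.ofLp w.ofLp := by
  rw [PiLp.inner_apply, opForm]
  refine Finset.sum_congr rfl fun i _ => ?_
  rw [matOp_apply, inner_sum]
  rfl

/-- A matrix over the Paulsen system is positive exactly if it is selfadjoint with nonnegative
quadratic form. -/
theorem mem_opCone_iff {n : ℕ} {x : Matrix (Fin n) (Fin n) (paulsen V)} :
    x ∈ opCone (paulsen V) n ↔ xᴴ = x ∧ ∀ v, 0 ≤ RCLike.re (opForm x v v) := by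
  have hre : ∀ v : PiLp 2 (fun _ : Fin n => WithLp 2 (H × K)),
      (matOp (x.map fun T => (T : WithLp 2 (H × K) →L[𝕜] WithLp 2 (H × K)))).reApplyInnerSelf v
        = RCLike.re (opForm x v.ofLp v.ofLp) := by
    intro v
    rw [ContinuousLinearMap.reApplyInnerSelf_apply, inner_re_symm, inner_matOp]
  constructor
  · rintro ⟨hsym, hpos⟩
    refine ⟨?_, fun v => ?_⟩
    · ext i j : 2
      refine ContinuousLinearMap.ext fun a => ext_inner_left 𝕜 fun b => ?_
      have h := hsym (PiLp.single 2 i b) (PiLp.single 2 j a)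
      change ⟪matOp _ _, _⟫_𝕜 = ⟪_, matOp _ _⟫_𝕜 at h
      rw [← inner_conj_symm, inner_matOp, inner_matOp, PiLp.ofLp_single, PiLp.ofLp_single,
        opForm_single, opForm_single, inner_conj_symm] at h
      rw [Matrix.conjTranspose_apply, coe_star_paulsen, ContinuousLinearMap.adjoint_inner_right, h]
    · rw [← hre (WithLp.toLp 2 v)]
      exact hpos _
  · rintro ⟨hherm, hpos⟩
    refine ⟨fun v w => ?_, fun v => ?_⟩
    · change ⟪matOp _ v, w⟫_𝕜 = ⟪v, matOp _ w⟫_𝕜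
      rw [← inner_conj_symm, inner_matOp, inner_matOp, ← RCLike.star_def, ← opForm_conjTranspose,
        hherm]
    · rw [hre]
      exact hpos _

theorem norm_coe_apply_le_opMatNorm {n : ℕ} (x : Matrix (Fin n) (Fin n) (paulsen V)) (i j : Fin n) :
    ‖(x i j).1‖ ≤ opMatNorm (paulsen V) n x := by
  refine ContinuousLinearMap.opNorm_le_bound _ (norm_nonneg _) fun a => ?_
  have h1 : matOp (x.map fun T => (T : WithLp 2 (H × K) →L[𝕜] WithLp 2 (H × K)))
      (PiLp.single 2 j a) i = (x i j).1 a := by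
    rw [matOp_apply, Finset.sum_eq_single j]
    · simp
    · intro l _ hl
      simp [hl]
    · simp
  rw [← h1]
  refine (PiLp.norm_apply_le _ i).trans ((ContinuousLinearMap.le_opNorm _ _).trans_eq ?_)
  rw [PiLp.norm_single]
  rfl

theorem eq_zero_of_opMatNorm_le_zero {n : ℕ} {x : Matrix (Fin n) (Fin n) (paulsen V)}
    (h : opMatNorm (paulsen V) n x ≤ 0) : x = 0 := by
  ext i j : 2
  exact norm_le_zero_iff.mp ((norm_coe_apply_le_opMatNorm x i j).trans h)

theorem opMatNorm_nonneg {n : ℕ} (x : Matrix (Fin n) (Fin n) (paulsen V)) :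
    0 ≤ opMatNorm (paulsen V) n x := norm_nonneg _

theorem opMatNorm_single (T : paulsen V) : opMatNorm (paulsen V) 1 (single T) = ‖T.1‖ := by
  refine le_antisymm ?_ (norm_coe_apply_le_opMatNorm (single T) 0 0)
  refine ContinuousLinearMap.opNorm_le_bound _ (norm_nonneg _) fun v => ?_
  refine le_of_sq_le_sq ?_ (by positivity)
  rw [mul_pow, PiLp.norm_sq_eq_of_L2, PiLp.norm_sq_eq_of_L2, Fin.sum_univ_one, Fin.sum_univ_one,
    matOp_apply, Fin.sum_univ_one, ← mul_pow]
  gcongr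
  exact ContinuousLinearMap.le_opNorm _ _

theorem norm_opForm_le {n : ℕ} (x : Matrix (Fin n) (Fin n) (paulsen V))
    (v w : Fin n → WithLp 2 (H × K)) :
    ‖opForm x v w‖ ≤ opMatNorm (paulsen V) n x * ‖WithLp.toLp 2 v‖ * ‖WithLp.toLp 2 w‖ := by
  rw [← inner_matOp x (WithLp.toLp 2 v) (WithLp.toLp 2 w)]
  refine (norm_inner_le_norm _ _).trans ?_
  rw [mul_comm (opMatNorm _ _ _), mul_assoc]
  gcongr
  exact ContinuousLinearMap.le_opNorm _ _

theorem isMatrixOrdered_opCone : IsMatrixOrdered 𝕜 (opCone (paulsen V)) where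
  selfadjoint n x hx := (mem_opCone_iff.mp hx).1
  zero_mem n := mem_opCone_iff.mpr ⟨by simp, fun v => by simp [opForm]⟩
  add_mem n x hx y hy := by
    rw [mem_opCone_iff] at hx hy ⊢
    refine ⟨by rw [Matrix.conjTranspose_add, hx.1, hy.1], fun v => ?_⟩
    rw [opForm_add, map_add]
    exact add_nonneg (hx.2 v) (hy.2 v)
  smul_mem n t ht x hx := by
    rw [mem_opCone_iff] at hx ⊢
    refine ⟨by rw [Matrix.conjTranspose_smul, hx.1, RCLike.star_def, RCLike.conj_ofReal],
      fun v => ?_⟩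
    rw [opForm_smul, RCLike.re_ofReal_mul]
    exact mul_nonneg ht (hx.2 v)
  proper n x hx hx' := by
    have h0 : matOp (x.map fun T => (T : WithLp 2 (H × K) →L[𝕜] WithLp 2 (H × K))) = 0 := ?_
    · refine eq_zero_of_opMatNorm_le_zero ?_
      rw [opMatNorm, h0, norm_zero]
    refine le_antisymm ?_ ((ContinuousLinearMap.nonneg_iff_isPositive _).mpr hx)
    rw [ContinuousLinearMap.le_def]
    have hx'' : (matOp ((-x).map fun T =>
      (T : WithLp 2 (H × K) →L[𝕜] WithLp 2 (H × K)))).IsPositive := hx'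
    convert hx'' using 1
    refine ContinuousLinearMap.ext fun v => PiLp.ext fun i => ?_
    simp [matOp_apply]
  compress n m a x hx := by
    rw [mem_opCone_iff] at hx ⊢
    rw [sandwich_eq_bimul]
    refine ⟨by rw [conjTranspose_bimul, hx.1, Matrix.conjTranspose_conjTranspose], fun v => ?_⟩
    rw [opForm_bimul]
    simpa using hx.2 fun k => ∑ i, a k i • v i

theorem isPos_opCone_iff {x : Matrix ι ι (paulsen V)} :
    IsPos 𝕜 (opCone (paulsen V)) x ↔ xᴴ = x ∧ ∀ v, 0 ≤ RCLike.re (opForm x v v) := by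
  classical
  constructor
  · intro h
    refine ⟨h.conjTranspose_eq isMatrixOrdered_opCone, fun v => ?_⟩
    let e := (Fintype.equivFin ι).symm
    have h1 := (mem_opCone_iff.mp ((isPos_fin_iff isMatrixOrdered_opCone).mp (h.submatrix e))).2
      (v ∘ e)
    convert h1 using 2
    rw [opForm, opForm, ← e.sum_comp]
    refine Finset.sum_congr rfl fun i _ => ?_
    rw [← e.sum_comp]
    rfl
  · rintro ⟨hherm, hpos⟩ n a
    refine mem_opCone_iff.mpr ⟨by rw [conjTranspose_bimul, hherm,
      Matrix.conjTranspose_conjTranspose], fun v => ?_⟩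
    rw [opForm_bimul]
    simpa using hpos fun k => ∑ i, a k i • v i

end PaulsenForm

/-! ### Order and norm in the Paulsen system -/

section PaulsenOrder

set_option linter.unusedSectionVars false

variable {𝕜 : Type*} [RCLike 𝕜]
  {H : Type*} [NormedAddCommGroup H] [InnerProductSpace 𝕜 H] [CompleteSpace H]
  {K : Type*} [NormedAddCommGroup K] [InnerProductSpace 𝕜 K] [CompleteSpace K]

/-- The identity operator as an element of the Paulsen system. -/
def paulsenOne (V : Submodule 𝕜 (K →L[𝕜] H)) : paulsen V := paulsenMk V 1 0 0 1

variable {V : Submodule 𝕜 (K →L[𝕜] H)}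

theorem coe_paulsenOne_apply (v : WithLp 2 (H × K)) : (paulsenOne V).1 v = v := by
  change blockOp 1 _ _ 1 v = v
  rw [blockOp_apply]
  simp
  rfl

theorem star_paulsenOne : star (paulsenOne V) = paulsenOne V := by
  refine Subtype.ext ?_
  rw [coe_star_paulsen, ← ContinuousLinearMap.star_eq_adjoint]
  change star (blockOp 1 _ _ 1) = blockOp 1 _ _ 1
  rw [star_blockOp, star_one]

theorem conjTranspose_unitDiag_paulsenOne (t : ℝ) (n : ℕ) :
    (unitDiag 𝕜 (paulsenOne V) t n)ᴴ = unitDiag 𝕜 (paulsenOne V) t n := by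
  rw [unitDiag, Matrix.diagonal_conjTranspose]
  congr 1
  ext i : 1
  rw [Pi.star_apply, star_smul, star_paulsenOne, RCLike.star_def, RCLike.conj_ofReal]

theorem opForm_unitDiag_paulsenOne (t : ℝ) {n : ℕ} (v : Fin n → WithLp 2 (H × K)) :
    opForm (unitDiag 𝕜 (paulsenOne V) t n) v v = ((t * ‖WithLp.toLp 2 v‖ ^ 2 : ℝ) : 𝕜) := by
  have h : ∀ i, ∑ j, ⟪v i, (unitDiag 𝕜 (paulsenOne V) t n i j).1 (v j)⟫_𝕜
      = ((t * ‖v i‖ ^ 2 : ℝ) : 𝕜) := by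
    intro i
    rw [Finset.sum_eq_single i]
    · rw [unitDiag, Matrix.diagonal_apply_eq, Submodule.coe_smul, smul_apply, coe_paulsenOne_apply,
        inner_smul_right, inner_self_eq_norm_sq_to_K]
      push_cast
      rfl
    · intro j _ hj
      rw [unitDiag, Matrix.diagonal_apply_ne _ hj.symm]
      simp [-WithLp.prod_inner_apply]
    · simp
  rw [opForm, Finset.sum_congr rfl fun i _ => h i, PiLp.norm_sq_eq_of_L2, Finset.mul_sum]
  push_cast
  rfl

theorem opCone_archimedean {n : ℕ} {x : Matrix (Fin n) (Fin n) (paulsen V)}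
    (h : ∀ ε : ℝ, 0 < ε → unitDiag 𝕜 (paulsenOne V) ε n + x ∈ opCone (paulsen V) n) :
    x ∈ opCone (paulsen V) n := by
  simp only [mem_opCone_iff, Matrix.conjTranspose_add, conjTranspose_unitDiag_paulsenOne,
    add_right_inj, opForm_add, opForm_unitDiag_paulsenOne, map_add, RCLike.ofReal_re] at h
  refine mem_opCone_iff.mpr ⟨(h 1 one_pos).1, fun v => le_of_forall_pos_le_add fun ε hε => ?_⟩
  have h1 := (h (ε / (‖WithLp.toLp 2 v‖ ^ 2 + 1)) (by positivity)).2 v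
  have h2 : ε / (‖WithLp.toLp 2 v‖ ^ 2 + 1) * ‖WithLp.toLp 2 v‖ ^ 2 ≤ ε := by
    rw [div_mul_eq_mul_div, div_le_iff₀ (by positivity)]
    nlinarith [norm_nonneg (WithLp.toLp 2 v)]
  linarith

theorem unitDiag_sub_mem_opCone {n : ℕ} {x : Matrix (Fin n) (Fin n) (paulsen V)} (hx : xᴴ = x)
    {r : ℝ} (h : opMatNorm (paulsen V) n x ≤ r) :
    unitDiag 𝕜 (paulsenOne V) r n - x ∈ opCone (paulsen V) n := by
  refine mem_opCone_iff.mpr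
    ⟨by rw [Matrix.conjTranspose_sub, hx, conjTranspose_unitDiag_paulsenOne], fun v => ?_⟩
  rw [opForm_sub, opForm_unitDiag_paulsenOne, map_sub, RCLike.ofReal_re, sub_nonneg]
  refine (RCLike.re_le_norm _).trans ((norm_opForm_le x v v).trans ?_)
  rw [mul_assoc, ← pow_two]
  gcongr

theorem isPos_fromBlocks_of_opMatNorm_le {n : ℕ} {u : Matrix (Fin n) (Fin n) (paulsen V)} {r : ℝ}
    (h : opMatNorm (paulsen V) n u ≤ r) :
    IsPos 𝕜 (opCone (paulsen V)) (Matrix.fromBlocks (unitDiag 𝕜 (paulsenOne V) r n) u uᴴ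
      (unitDiag 𝕜 (paulsenOne V) r n)) := by
  refine isPos_opCone_iff.mpr ⟨?_, fun v => ?_⟩
  · rw [Matrix.fromBlocks_conjTranspose, conjTranspose_unitDiag_paulsenOne,
      Matrix.conjTranspose_conjTranspose]
  · rw [opForm_fromBlocks, opForm_conjTranspose, opForm_unitDiag_paulsenOne,
      opForm_unitDiag_paulsenOne]
    simp only [map_add, RCLike.ofReal_re, RCLike.star_def, RCLike.conj_re]
    set a := ‖WithLp.toLp 2 (v ∘ Sum.inl)‖
    set b := ‖WithLp.toLp 2 (v ∘ Sum.inr)‖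
    have ha : 0 ≤ a := norm_nonneg _
    have hb : 0 ≤ b := norm_nonneg _
    have h1 := (abs_le.mp (RCLike.abs_re_le_norm (opForm u (v ∘ Sum.inl) (v ∘ Sum.inr)))).1
    have h2 := norm_opForm_le u (v ∘ Sum.inl) (v ∘ Sum.inr)
    have h3 : opMatNorm (paulsen V) n u * a * b ≤ r * (a * b) := by
      rw [mul_assoc]
      gcongr
    have hr : 0 ≤ r := (opMatNorm_nonneg u).trans h
    have h4 : 0 ≤ r * (a - b) ^ 2 := by positivity
    nlinarith

theorem opMatNorm_le_of_isPos_fromBlocks {n : ℕ} {u : Matrix (Fin n) (Fin n) (paulsen V)} {r : ℝ}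
    (hr : 0 < r)
    (h : IsPos 𝕜 (opCone (paulsen V)) (Matrix.fromBlocks (unitDiag 𝕜 (paulsenOne V) r n) u uᴴ
      (unitDiag 𝕜 (paulsenOne V) r n))) : opMatNorm (paulsen V) n u ≤ r := by
  refine ContinuousLinearMap.opNorm_le_bound _ hr.le fun w => ?_
  set z := matOp (u.map fun T => (T : WithLp 2 (H × K) →L[𝕜] WithLp 2 (H × K))) w with hz
  -- The form is evaluated at the pair `(-u w, r w)`.
  have h1 := (isPos_opCone_iff.mp h).2 (Sum.elim (-z.ofLp) (((r : 𝕜) • w).ofLp))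
  rw [opForm_fromBlocks, opForm_conjTranspose, opForm_unitDiag_paulsenOne,
    opForm_unitDiag_paulsenOne, Sum.elim_comp_inl, Sum.elim_comp_inr, opForm_neg_left,
    ← inner_matOp, map_smul, ← hz, inner_smul_right, inner_self_eq_norm_sq_to_K] at h1
  have h2 : ‖WithLp.toLp 2 (-z.ofLp)‖ = ‖z‖ := norm_neg z
  have h3 : ‖WithLp.toLp 2 (((r : 𝕜) • w).ofLp)‖ = r * ‖w‖ := by
    change ‖(r : 𝕜) • w‖ = _
    rw [norm_smul, RCLike.norm_ofReal, abs_of_pos hr]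
  have h4 : -((r : 𝕜) * (‖z‖ : 𝕜) ^ 2) = ((-(r * ‖z‖ ^ 2) : ℝ) : 𝕜) := by push_cast; rfl
  rw [h2, h3] at h1
  change 0 ≤ RCLike.re ((((r * ‖z‖ ^ 2 : ℝ) : 𝕜) + -((r : 𝕜) * (‖z‖ : 𝕜) ^ 2)) +
    (star (-((r : 𝕜) * (‖z‖ : 𝕜) ^ 2)) + ((r * (r * ‖w‖) ^ 2 : ℝ) : 𝕜))) at h1
  rw [h4] at h1
  simp only [map_add, RCLike.ofReal_re, RCLike.star_def, RCLike.conj_ofReal] at h1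
  refine le_of_sq_le_sq ?_ (by positivity)
  have h5 : 0 ≤ r * ((r * ‖w‖) ^ 2 - ‖z‖ ^ 2) := by nlinarith
  linarith [nonneg_of_mul_nonneg_right h5 hr]

/-- The cones are closed for the operator norms. -/
theorem opCone_normClosed (n : ℕ) :
    NormClosed (opMatNorm (paulsen V) n) (opCone (paulsen V) n) := by
  intro x hx
  have hherm : xᴴ = x := by
    ext i j : 2
    refine sub_eq_zero.mp (norm_le_zero_iff.mp (le_of_forall_pos_le_add fun ε hε => ?_))
    obtain ⟨y, hy, hxy⟩ := hx (ε / 2) (half_pos hε)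
    have hyh := congrFun (congrFun (mem_opCone_iff.mp hy).1 i) j
    have h1 := (norm_coe_apply_le_opMatNorm (x - y) i j).trans hxy.le
    have h2 := (norm_coe_apply_le_opMatNorm (x - y) j i).trans hxy.le
    rw [Matrix.conjTranspose_apply] at hyh ⊢
    have h3 : ((star (x j i) : paulsen V) : WithLp 2 (H × K) →L[𝕜] WithLp 2 (H × K)) - (x i j).1
        = ContinuousLinearMap.adjoint ((x - y) j i).1 - ((x - y) i j).1 := by
      have h4 := congrArg (fun T : paulsen V => T.1) hyh
      simp only [coe_star_paulsen] at h4
      rw [coe_star_paulsen, Matrix.sub_apply, Matrix.sub_apply, Submodule.coe_sub,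
        Submodule.coe_sub, map_sub, h4]
      abel
    rw [h3]
    refine (norm_sub_le _ _).trans ?_
    rw [LinearIsometryEquiv.norm_map]
    linarith
  refine mem_opCone_iff.mpr ⟨hherm, fun v => le_of_forall_pos_le_add fun ε hε => ?_⟩
  obtain ⟨y, hy, hxy⟩ := hx (ε / (‖WithLp.toLp 2 v‖ ^ 2 + 1)) (by positivity)
  have h1 := (mem_opCone_iff.mp hy).2 v
  have h2 := norm_opForm_le (x - y) v v
  have h3 := (abs_le.mp (RCLike.abs_re_le_norm (opForm (x - y) v v))).1
  rw [opForm_sub, map_sub] at h3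
  have h4 : opMatNorm (paulsen V) n (x - y) * ‖WithLp.toLp 2 v‖ * ‖WithLp.toLp 2 v‖
      ≤ ε / (‖WithLp.toLp 2 v‖ ^ 2 + 1) * (‖WithLp.toLp 2 v‖ * ‖WithLp.toLp 2 v‖) := by
    rw [mul_assoc]
    gcongr
  have h5 : ε / (‖WithLp.toLp 2 v‖ ^ 2 + 1) * (‖WithLp.toLp 2 v‖ * ‖WithLp.toLp 2 v‖) ≤ ε := by
    rw [div_mul_eq_mul_div, div_le_iff₀ (by positivity)]
    nlinarith [norm_nonneg (WithLp.toLp 2 v)]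
  rw [opForm_sub] at h2
  linarith

end PaulsenOrder

/-! ### The trace on the Paulsen system -/

section PaulsenTrace

set_option linter.unusedSectionVars false

variable {𝕜 : Type*} [RCLike 𝕜]
  {H : Type*} [NormedAddCommGroup H] [InnerProductSpace 𝕜 H] [CompleteSpace H]
  {K : Type*} [NormedAddCommGroup K] [InnerProductSpace 𝕜 K] [CompleteSpace K]
  {V : Submodule 𝕜 (K →L[𝕜] H)}

theorem vecFunctional_selfadjoint (v : WithLp 2 (H × K)) :
    IsSelfadjointFunctional (vecFunctional (paulsen V) v) := by
  intro T
  change ⟪v, (star T).1 v⟫_𝕜 = star ⟪v, T.1 v⟫_𝕜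
  rw [coe_star_paulsen, ContinuousLinearMap.adjoint_inner_right, RCLike.star_def, inner_conj_symm]

theorem vecFunctional_nonneg (v : WithLp 2 (H × K)) {x : paulsen V}
    (hx : single x ∈ opCone (paulsen V) 1) : 0 ≤ vecFunctional (paulsen V) v x := by
  obtain ⟨h1, h2⟩ := mem_opCone_iff.mp hx
  have h3 : star x = x := congrFun (congrFun h1 0) 0
  rw [RCLike.nonneg_iff]
  refine ⟨?_, ?_⟩
  · have := h2 fun _ => v
    simp only [opForm, Fin.sum_univ_one] at this
    exact this
  · have h4 := vecFunctional_selfadjoint v x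
    rw [h3, RCLike.star_def, eq_comm, RCLike.conj_eq_iff_im] at h4
    exact h4

theorem vecFunctional_map_posSemidef (v : WithLp 2 (H × K)) {n : ℕ}
    {x : Matrix (Fin n) (Fin n) (paulsen V)} (hx : x ∈ opCone (paulsen V) n) :
    (x.map (vecFunctional (paulsen V) v)).PosSemidef :=
  ((isPos_fin_iff isMatrixOrdered_opCone).mpr hx).map_posSemidef (vecFunctional_selfadjoint v)
    isMatrixOrdered_opCone fun _ h => vecFunctional_nonneg v h

/-- A positive semidefinite scalar matrix acts positively on families of vectors. -/
theorem re_sum_inner_nonneg {X : Type*} [NormedAddCommGroup X] [InnerProductSpace 𝕜 X] {n : ℕ}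
    {M : Matrix (Fin n) (Fin n) 𝕜} (hM : M.PosSemidef) (h : Fin n → X) :
    0 ≤ RCLike.re (∑ i, ∑ j, M i j * ⟪h i, h j⟫_𝕜) := by
  obtain ⟨a, -, -, ha, -, -, -, -, -, -, -, haa⟩ := exists_sqrt_inverse_kernel hM
  have key : ∑ i, ∑ j, M i j * ⟪h i, h j⟫_𝕜
      = ∑ k, ⟪∑ i, a k i • h i, ∑ j, a k j • h j⟫_𝕜 := by
    have hMa : ∀ i j, M i j = ∑ k, star (a k i) * a k j := fun i j => by
      rw [← haa, Matrix.mul_apply]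
      exact Finset.sum_congr rfl fun k _ => by rw [← Matrix.conjTranspose_apply, ha.1.eq]
    calc ∑ i, ∑ j, M i j * ⟪h i, h j⟫_𝕜
        = ∑ i, ∑ k, ∑ j, star (a k i) * a k j * ⟪h i, h j⟫_𝕜 := by
          refine Finset.sum_congr rfl fun i _ => ?_
          simp only [hMa, Finset.sum_mul]
          exact Finset.sum_comm
      _ = ∑ k, ∑ i, ∑ j, star (a k i) * a k j * ⟪h i, h j⟫_𝕜 := Finset.sum_comm
      _ = _ := by
          refine Finset.sum_congr rfl fun k _ => ?_
          rw [sum_inner]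
          refine Finset.sum_congr rfl fun i _ => ?_
          rw [inner_sum]
          refine Finset.sum_congr rfl fun j _ => ?_
          rw [inner_smul_left, inner_smul_right, RCLike.star_def, mul_assoc]
  rw [key, map_sum]
  exact Finset.sum_nonneg fun k _ => inner_self_nonneg

variable [Nontrivial H] [Nontrivial K]

theorem inner_coe_inl (T : paulsen V) (h h' : H) :
    ⟪(WithLp.toLp 2 (h, (0 : K)) : WithLp 2 (H × K)), T.1 (WithLp.toLp 2 (h', (0 : K)))⟫_𝕜
      = vecFunctional (paulsen V) (WithLp.toLp 2 ((exists_unit_vector 𝕜 H).choose, (0 : K))) T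
        * ⟪h, h'⟫_𝕜 := by
  obtain ⟨_, a, b, x, -, y, -, rfl⟩ := T
  have h1 := (exists_unit_vector 𝕜 H).choose_spec
  simp [vecFunctional, blockOp_apply, WithLp.prod_inner_apply, inner_smul_right, h1]

theorem inner_coe_inr (T : paulsen V) (k k' : K) :
    ⟪(WithLp.toLp 2 ((0 : H), k) : WithLp 2 (H × K)), T.1 (WithLp.toLp 2 ((0 : H), k'))⟫_𝕜
      = vecFunctional (paulsen V) (WithLp.toLp 2 ((0 : H), (exists_unit_vector 𝕜 K).choose)) T
        * ⟪k, k'⟫_𝕜 := by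
  obtain ⟨_, a, b, x, -, y, -, rfl⟩ := T
  have h1 := (exists_unit_vector 𝕜 K).choose_spec
  simp [vecFunctional, blockOp_apply, WithLp.prod_inner_apply, inner_smul_right, h1]

theorem two_mul_trLin_apply (T : paulsen V) : 2 * trLin V T
    = vecFunctional (paulsen V) (WithLp.toLp 2 ((exists_unit_vector 𝕜 H).choose, (0 : K))) T
      + vecFunctional (paulsen V) (WithLp.toLp 2 ((0 : H), (exists_unit_vector 𝕜 K).choose)) T := by
  simp [trLin]
  ring

theorem re_sum_inner_le {X : Type*} [NormedAddCommGroup X] [InnerProductSpace 𝕜 X] {n : ℕ}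
    {M : Matrix (Fin n) (Fin n) 𝕜} {r : ℝ}
    (hM : ((r : 𝕜) • (1 : Matrix (Fin n) (Fin n) 𝕜) - M).PosSemidef) (w : Fin n → X) :
    RCLike.re (∑ i, ∑ j, M i j * ⟪w i, w j⟫_𝕜) ≤ r * ∑ i, ‖w i‖ ^ 2 := by
  have h3 := re_sum_inner_nonneg hM w
  simp only [Matrix.sub_apply, Matrix.smul_apply, smul_eq_mul, sub_mul,
    Finset.sum_sub_distrib, map_sub, sub_nonneg] at h3
  refine h3.trans_eq ?_
  have h4 : ∀ i, ∑ j, (r : 𝕜) * (1 : Matrix (Fin n) (Fin n) 𝕜) i j * ⟪w i, w j⟫_𝕜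
      = ((r * ‖w i‖ ^ 2 : ℝ) : 𝕜) := by
    intro i
    rw [Finset.sum_eq_single i]
    · rw [Matrix.one_apply_eq, inner_self_eq_norm_sq_to_K]
      push_cast
      ring
    · intro j _ hj
      rw [Matrix.one_apply_ne hj.symm]
      simp
    · simp
  rw [Finset.sum_congr rfl fun i _ => h4 i, ← RCLike.ofReal_sum, RCLike.ofReal_re,
    Finset.mul_sum]

/-- A positive matrix `p` with trace at most `r` satisfies `p ≤ 4 r`: up to a factor `2` it is
dominated by its diagonal part, and each diagonal entry is dominated by their sum, which is twice
the trace. -/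
theorem unitDiag_sub_mem_opCone_of_trace_le {n : ℕ} {p : Matrix (Fin n) (Fin n) (paulsen V)}
    (hp : p ∈ opCone (paulsen V) n) {r : ℝ}
    (h : ((r : 𝕜) • (1 : Matrix (Fin n) (Fin n) 𝕜) - p.map (trLin V)).PosSemidef) :
    unitDiag 𝕜 (paulsenOne V) (4 * r) n - p ∈ opCone (paulsen V) n := by
  obtain ⟨hherm, hpos⟩ := mem_opCone_iff.mp hp
  refine mem_opCone_iff.mpr
    ⟨by rw [Matrix.conjTranspose_sub, hherm, conjTranspose_unitDiag_paulsenOne], fun v => ?_⟩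
  rw [opForm_sub, opForm_unitDiag_paulsenOne, map_sub, RCLike.ofReal_re]
  set α := vecFunctional (paulsen V)
    (WithLp.toLp 2 ((exists_unit_vector 𝕜 H).choose, (0 : K))) with hα
  set β := vecFunctional (paulsen V)
    (WithLp.toLp 2 ((0 : H), (exists_unit_vector 𝕜 K).choose)) with hβ
  have h2 : (0 : 𝕜) ≤ 2 := by exact_mod_cast (zero_le_two : (0 : ℝ) ≤ 2)
  have hA : (((2 * r : ℝ) : 𝕜) • (1 : Matrix (Fin n) (Fin n) 𝕜) - p.map α).PosSemidef := by
    convert (h.smul h2).add (vecFunctional_map_posSemidef (V := V)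
      (WithLp.toLp 2 ((0 : H), (exists_unit_vector 𝕜 K).choose)) hp) using 1
    ext i j
    have := two_mul_trLin_apply (p i j)
    rw [← hα, ← hβ] at this
    simp only [Matrix.sub_apply, Matrix.add_apply, Matrix.smul_apply, Matrix.map_apply,
      smul_eq_mul, ← hβ]
    push_cast
    linear_combination this
  have hB : (((2 * r : ℝ) : 𝕜) • (1 : Matrix (Fin n) (Fin n) 𝕜) - p.map β).PosSemidef := by
    convert (h.smul h2).add (vecFunctional_map_posSemidef (V := V)
      (WithLp.toLp 2 ((exists_unit_vector 𝕜 H).choose, (0 : K))) hp) using 1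
    ext i j
    have := two_mul_trLin_apply (p i j)
    rw [← hα, ← hβ] at this
    simp only [Matrix.sub_apply, Matrix.add_apply, Matrix.smul_apply, Matrix.map_apply,
      smul_eq_mul, ← hα]
    push_cast
    linear_combination this
  -- The reflection `(h, k) ↦ (h, -k)` removes the off-diagonal part.
  set a : Fin n → WithLp 2 (H × K) := fun i => WithLp.toLp 2 ((v i).fst, (0 : K)) with ha
  set b : Fin n → WithLp 2 (H × K) := fun i => WithLp.toLp 2 ((0 : H), (v i).snd) with hb
  have hv : v = a + b := by
    ext i : 1
    simp only [ha, hb, Pi.add_apply, ← WithLp.toLp_add, Prod.mk_add_mk, add_zero, zero_add]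
    rfl
  have hpar : opForm p (a + b) (a + b) + opForm p (a + -b) (a + -b)
      = 2 * opForm p a a + 2 * opForm p b b := by
    simp only [opForm_add_left, opForm_add_right, opForm_neg_left, opForm_neg_right]
    ring
  have hre := congrArg RCLike.re hpar
  have hneg := hpos (a + -b)
  have hfa : opForm p a a = ∑ i, ∑ j, α (p i j) * ⟪(v i).fst, (v j).fst⟫_𝕜 := by
    simp only [opForm, ha, inner_coe_inl, ← hα]
  have hfb : opForm p b b = ∑ i, ∑ j, β (p i j) * ⟪(v i).snd, (v j).snd⟫_𝕜 := by
    simp only [opForm, hb, inner_coe_inr, ← hβ]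
  have ha2 := re_sum_inner_le hA fun i => (v i).fst
  have hb2 := re_sum_inner_le hB fun i => (v i).snd
  simp only [Matrix.map_apply] at ha2 hb2
  rw [← hfa] at ha2
  rw [← hfb] at hb2
  have hnorm : ‖WithLp.toLp 2 v‖ ^ 2 = ∑ i, ‖(v i).fst‖ ^ 2 + ∑ i, ‖(v i).snd‖ ^ 2 := by
    rw [PiLp.norm_sq_eq_of_L2, ← Finset.sum_add_distrib]
    exact Finset.sum_congr rfl fun i _ => WithLp.prod_norm_sq_eq_of_L2 (v i)
  rw [← hv, map_add, map_add, two_mul, two_mul, map_add, map_add] at hre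
  rw [hnorm]
  linarith

theorem trLin_selfadjoint : IsSelfadjointFunctional (trLin V) := by
  intro T
  have h1 := vecFunctional_selfadjoint (V := V)
    (WithLp.toLp 2 ((exists_unit_vector 𝕜 H).choose, (0 : K))) T
  have h2 := vecFunctional_selfadjoint (V := V)
    (WithLp.toLp 2 ((0 : H), (exists_unit_vector 𝕜 K).choose)) T
  simp only [trLin, LinearMap.smul_apply, LinearMap.add_apply, h1, h2, smul_eq_mul, star_mul',
    star_add]
  simp

theorem trLin_nonneg {x : paulsen V} (hx : single x ∈ opCone (paulsen V) 1) : 0 ≤ trLin V x := by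
  have h2 : (0 : 𝕜) ≤ 1 / 2 := by
    rw [show (1 / 2 : 𝕜) = ((1 / 2 : ℝ) : 𝕜) by push_cast; rfl]
    exact RCLike.ofReal_nonneg.mpr (by norm_num)
  exact mul_nonneg h2 (add_nonneg (vecFunctional_nonneg _ hx) (vecFunctional_nonneg _ hx))

theorem trLin_paulsenOne : trLin V (paulsenOne V) = 1 := by
  rw [paulsenOne, trLin_mk]
  norm_num

theorem unitDiag_one_mem_paulsenBase (n : ℕ) :
    unitDiag 𝕜 (paulsenOne V) 1 n ∈ paulsenBase V n := by
  refine ⟨mem_opCone_iff.mpr ⟨conjTranspose_unitDiag_paulsenOne 1 n, fun v => ?_⟩, ?_⟩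
  · rw [opForm_unitDiag_paulsenOne, RCLike.ofReal_re]
    positivity
  · change (unitDiag 𝕜 (paulsenOne V) 1 n).map (trLin V) = 1
    ext i j
    by_cases h : i = j
    · subst h
      simp [unitDiag, trLin_paulsenOne]
    · simp [unitDiag, h]

theorem smul_unitDiag_one (t : ℝ) (n : ℕ) :
    (t : 𝕜) • unitDiag 𝕜 (paulsenOne V) 1 n = unitDiag 𝕜 (paulsenOne V) t n := by
  rw [unitDiag, unitDiag, ← Matrix.diagonal_smul]
  congr 1
  ext i : 1
  change (t : 𝕜) • ((1 : ℝ) : 𝕜) • paulsenOne V = (t : 𝕜) • paulsenOne V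
  rw [smul_smul, RCLike.ofReal_one, mul_one]

theorem isMatrixBaseOrdered_paulsen :
    IsMatrixBaseOrdered (opCone (paulsen V)) (paulsenBase V) (trLin V) where
  matrixOrdered := isMatrixOrdered_opCone
  matrixConvex := isMatrixConvex_baseOf isMatrixOrdered_opCone
  selfadjoint := trLin_selfadjoint
  positive x hx := trLin_nonneg hx
  faithful x hx h0 := by
    have h1 := unitDiag_sub_mem_opCone_of_trace_le hx (r := 0) (by
      convert Matrix.PosSemidef.zero using 1
      ext i j
      simp [single, h0])
    have h2 := isMatrixOrdered_opCone.proper 1 _ hx (by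
      convert h1 using 1
      ext i j : 1
      simp [unitDiag])
    exact congrFun (congrFun h2 0) 0
  base_eq n := rfl
  dominated n x hx := by
    refine ⟨opMatNorm (paulsen V) n x + 1, by linarith [opMatNorm_nonneg x], _,
      unitDiag_one_mem_paulsenBase n, ?_⟩
    rw [smul_unitDiag_one]
    exact unitDiag_sub_mem_opCone hx (by linarith)
  separated n x hx h := by
    have hC : IsMatrixOrdered 𝕜 (opCone (paulsen V)) := isMatrixOrdered_opCone
    have hle : ∀ ε : ℝ, ∀ y ∈ opCone (paulsen V) n, ‖ampl (trLin V) y‖ < ε / 4 →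
        unitDiag 𝕜 (paulsenOne V) ε n - y ∈ opCone (paulsen V) n := by
      intro ε y hy hn
      have h1 := unitDiag_sub_mem_opCone_of_trace_le hy (posSemidef_smul_one_sub
        ((((isPos_fin_iff hC).mpr hy).map_posSemidef trLin_selfadjoint hC
          fun _ h => trLin_nonneg h).1) hn.le)
      rwa [mul_div_cancel₀ _ (four_ne_zero)] at h1
    refine hC.proper n x (opCone_archimedean fun ε hε => ?_) (opCone_archimedean fun ε hε => ?_)
    · obtain ⟨y, hy, z, hz, rfl, -, hzn⟩ := h (ε / 4) (by positivity)
      convert hC.add_mem n _ (hle ε z hz hzn) _ hy using 1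
      abel
    · obtain ⟨y, hy, z, hz, rfl, hyn, -⟩ := h (ε / 4) (by positivity)
      convert hC.add_mem n _ (hle ε y hy hyn) _ hz using 1
      abel

theorem tauNorm_le_opMatNorm {n : ℕ} (u : Matrix (Fin n) (Fin n) (paulsen V)) :
    tauNorm V n u ≤ opMatNorm (paulsen V) n u := by
  refine BaseBound.baseNorm_le isMatrixBaseOrdered_paulsen (opMatNorm_nonneg u)
    ⟨_, _, isPos_fromBlocks_of_opMatNorm_le le_rfl, ?_, ?_⟩
  all_goals
    rw [← smul_unitDiag_one]
    have h1 : (unitDiag 𝕜 (paulsenOne V) 1 n).map (trLin V) = 1 :=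
      (unitDiag_one_mem_paulsenBase n).2
    rw [Matrix.map_smul _ _ (map_smul (trLin V) _), h1, sub_self]
    exact Matrix.PosSemidef.zero

theorem opMatNorm_le_tauNorm {n : ℕ} (u : Matrix (Fin n) (Fin n) (paulsen V)) :
    opMatNorm (paulsen V) n u ≤ 4 * tauNorm V n u := by
  have hC : IsMatrixOrdered 𝕜 (opCone (paulsen V)) := isMatrixOrdered_opCone
  have h0 : 0 ≤ tauNorm V n u := baseNormSa_nonneg _ _
  have key : ∀ s, tauNorm V n u < s → opMatNorm (paulsen V) n u ≤ 4 * s := by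
    intro s hs
    obtain ⟨p, q, h, hp, hq⟩ := baseBound_of_baseNorm_lt isMatrixBaseOrdered_paulsen hs
    refine opMatNorm_le_of_isPos_fromBlocks (by linarith) ?_
    have hp' := unitDiag_sub_mem_opCone_of_trace_le ((isPos_fin_iff hC).mp h.fromBlocks₁₁) hp
    have hq' := unitDiag_sub_mem_opCone_of_trace_le ((isPos_fin_iff hC).mp h.fromBlocks₂₂) hq
    have hd := ((isPos_fin_iff hC).mpr hp').fromBlocks_diagonal hC ((isPos_fin_iff hC).mpr hq')
    convert h.add hC hd using 1
    rw [Matrix.fromBlocks_add]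
    simp
  refine le_of_forall_pos_le_add fun ε hε => ?_
  have := key (tauNorm V n u + ε / 4) (by linarith)
  linarith

theorem isNcBaseNormSpace_paulsen :
    IsNcBaseNormSpace (opCone (paulsen V)) (tauNorm V) (paulsenBase V) (trLin V) := by
  have hB := isMatrixBaseOrdered_paulsen (V := V)
  have hcone : ∀ n, NormClosed (tauNorm V n) (opCone (paulsen V) n) := by
    refine fun n x hx => opCone_normClosed n x fun ε hε => ?_
    obtain ⟨y, hy, hxy⟩ := hx (ε / 4) (by positivity)
    exact ⟨y, hy, (opMatNorm_le_tauNorm _).trans_lt (by linarith)⟩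
  have hplane : ∀ n, NormClosed (tauNorm V n) (ncHyperplane (trLin V) n) := by
    intro n x hx
    obtain ⟨c, hc⟩ := trLin_mem V
    ext i j
    refine sub_eq_zero.mp (norm_le_zero_iff.mp (le_of_forall_pos_le_add fun ε hε => ?_))
    obtain ⟨y, hy, hxy⟩ := hx (ε / (4 * (|c| + 1))) (by positivity)
    have hy' : ampl (trLin V) y = 1 := hy
    have h1 : ampl (trLin V) x i j - (1 : Matrix (Fin n) (Fin n) 𝕜) i j
        = trLin V ((x - y) i j) := by
      rw [← hy', Matrix.sub_apply, map_sub]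
      rfl
    rw [h1, zero_add]
    calc ‖trLin V ((x - y) i j)‖ ≤ c * ‖((x - y) i j).1‖ := hc _
      _ ≤ (|c| + 1) * (4 * (ε / (4 * (|c| + 1)))) := by
        gcongr
        · exact (le_abs_self c).trans (le_add_of_nonneg_right zero_le_one)
        · exact (norm_coe_apply_le_opMatNorm (x - y) i j).trans
            ((opMatNorm_le_tauNorm _).trans (by linarith))
      _ = ε := by
        have : |c| + 1 ≠ 0 := by positivity
        field_simp
  exact
    { matrixOrdered := hB.matrixOrdered
      operatorSpace := isOperatorSpace_baseNorm hB
      cone_closed := hcone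
      star_isometric := fun n x => baseNorm_conjTranspose hB x
      matrixConvex := hB.matrixConvex
      base_subset := fun n x hx => ⟨hx.1, baseNorm_le_one_of_mem hB hx⟩
      base_closed := fun n x hx =>
        ⟨hcone n x fun ε hε => (hx ε hε).imp fun y hy => ⟨hy.1.1, hy.2⟩,
          hplane n x fun ε hε => (hx ε hε).imp fun y hy => ⟨hy.1.2, hy.2⟩⟩
      ball_subset := fun t ht n x hx h1 =>
        exists_sandwich_sub_of_baseNorm_lt hB hx (lt_of_le_of_lt h1 ht)
      hyperplane_closed := hplane
      selfadjoint := hB.selfadjoint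
      positive := hB.positive
      base_eq := hB.base_eq }

/-- The functionals bounded for the nc base norm are those bounded for the operator norm. -/
theorem exists_paulsenDual_eq_iff (φ : paulsen V →ₗ[𝕜] 𝕜) :
    (∃ ψ, (paulsenDual V).subtype ψ = φ) ↔
      ∃ c : ℝ, ∀ x, ‖φ x‖ ≤ c * baseNorm (opCone (paulsen V)) (trLin V) 1 (single x) := by
  constructor
  · rintro ⟨⟨φ, c, hc⟩, rfl⟩
    refine ⟨|c| * 4, fun x => (hc x).trans ?_⟩
    rw [mul_assoc, ← opMatNorm_single]
    have h1 := opMatNorm_le_tauNorm (single x)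
    have h2 := opMatNorm_nonneg (single x)
    exact (mul_le_mul_of_nonneg_right (le_abs_self c) h2).trans
      (mul_le_mul_of_nonneg_left h1 (abs_nonneg c))
  · rintro ⟨c, hc⟩
    refine ⟨⟨φ, |c|, fun x => (hc x).trans ?_⟩, rfl⟩
    rw [← opMatNorm_single]
    have h1 := tauNorm_le_opMatNorm (single x)
    have h2 : 0 ≤ tauNorm V 1 (single x) := baseNormSa_nonneg _ _
    exact (mul_le_mul_of_nonneg_right (le_abs_self c) h2).trans
      (mul_le_mul_of_nonneg_left h1 (abs_nonneg c))

end PaulsenTrace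

end NcBase

end

theorem theorem5p2 {𝕜 : Type*} [RCLike 𝕜]
    {H : Type*} [NormedAddCommGroup H] [InnerProductSpace 𝕜 H] [CompleteSpace H] [Nontrivial H]
    {K : Type*} [NormedAddCommGroup K] [InnerProductSpace 𝕜 K] [CompleteSpace K] [Nontrivial K]
    (V : Submodule 𝕜 (K →L[𝕜] H)) :
    -- a matrix base ordered space with nc base cut out by the normalized trace
    NcBase.IsMatrixBaseOrdered (NcBase.opCone (NcBase.paulsen V)) (NcBase.paulsenBase V)
      (NcBase.trLin V) ∧
    NcBase.IsBasedOn 𝕜 (NcBase.opCone (NcBase.paulsen V)) (NcBase.paulsenBase V) ∧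
    -- the two formulas for the base norm agree on selfadjoint matrices
    (∀ (n : ℕ) (u : Matrix (Fin n) (Fin n) (NcBase.paulsen V)), uᴴ = u →
      NcBase.tauNorm V n u
        = NcBase.baseNormSa (NcBase.opCone (NcBase.paulsen V)) (NcBase.trLin V) n u) ∧
    -- with these norms, a nc base norm space
    NcBase.IsNcBaseNormSpace (NcBase.opCone (NcBase.paulsen V)) (NcBase.tauNorm V)
      (NcBase.paulsenBase V) (NcBase.trLin V) ∧
    -- equivalence with the original matrix norms
    (∀ (n : ℕ) (u : Matrix (Fin n) (Fin n) (NcBase.paulsen V)),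
      (1 / 2) * NcBase.tauNorm V n u ≤ NcBase.opMatNorm (NcBase.paulsen V) n u ∧
      NcBase.opMatNorm (NcBase.paulsen V) n u ≤ 4 * NcBase.tauNorm V n u) ∧
    -- the matrix ordered dual is an operator system with unit the trace, and with its matrix
    -- order unit norms it is the operator space dual for the nc base norms
    NcBase.IsOperatorSystem 𝕜 (NcBase.dualPos V) (NcBase.trDual V) ∧
    NcBase.IsOperatorSpaceDual (NcBase.tauNorm V) (NcBase.dualNorm V)
      (NcBase.paulsenDual V).subtype := by
  have hB := NcBase.isMatrixBaseOrdered_paulsen (V := V)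
  have hj : Function.Injective (NcBase.paulsenDual V).subtype := Subtype.val_injective
  refine ⟨hB, NcBase.isBasedOn_base hB, fun n u hu => NcBase.baseNorm_eq_baseNormSa hB hu,
    NcBase.isNcBaseNormSpace_paulsen, fun n u => ⟨?_, NcBase.opMatNorm_le_tauNorm u⟩, ?_, ?_⟩
  · have h1 := NcBase.tauNorm_le_opMatNorm u
    have h2 : 0 ≤ NcBase.tauNorm V n u := NcBase.baseNormSa_nonneg _ _
    linarith
  · exact NcBase.isOperatorSystem_dualCone hB hj (NcBase.star_paulsenDual_apply V) rfl
      fun φ => (NcBase.exists_paulsenDual_eq_iff _).mp ⟨φ, rfl⟩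
  · exact NcBase.isOperatorSpaceDual_dualCone hB hj (NcBase.star_paulsenDual_apply V) rfl
      NcBase.exists_paulsenDual_eq_iff
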